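/- Let $k$ be a field, $\boldsymbol x$ a finite set of indeterminates of degree one, $B=k[\boldsymbol x]$ and $e=|\boldsymbol x|$. For a homogeneous ideal $I\subseteq B$ and $j\in\mathbb Z$ let $I_j$ be the $k$-space of forms of degree $j$ in $I$ (so $I_j=0$ for $j<0$), let $I_{\langle j\rangle}:=B\,I_j$ be the ideal generated by $I_j$, and put $n_j:=\operatorname{rank}_k I_j$ and $$\mathbb J:=\{\,j\in\mathbb Z \mid I_j\ne B_1I_{j-1}\,\}.$$ Let $\beta^B_{i,j}(I):=\operatorname{rank}_k\operatorname{Tor}^B_i(I,k)_j$ be the graded Betti numbers, where the grading on $\operatorname{Tor}$ is inherited from resolutions by graded free $B$-modules, and let $$P^B_I(y,z):=\sum_{i\ge 0}\sum_{j\in\mathbb Z}\beta^B_{i,j}(I)\,y^jz^i\in\mathbb Z[y^{\pm1}][[z]]$$ be the graded Poincaré series. For a homogeneous ideal $J$ write $H_{B/J}(u):=\sum_{n\ge 0}\operatorname{rank}_k (B/J)_n\,u^n$. The ideal $I$ is called componentwise linear if for every $j\in\mathbb Z$ the ideal $I_{\langle j\rangle}$ is $j$-linear, that is, $\beta^B_{i,h}(I_{\langle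 j\rangle})=0$ whenever $h\ne i+j$. If $I$ is componentwise linear, then $\mathbb J$ is finite and the following equality holds in $\mathbb Z[y^{\pm1}]((z))$: $$P^B_I(y,z)=(1+yz)^e\sum_{j\in\mathbb J}(-z)^{-j}\bigl(H_{B/I_{\langle j-1\rangle}}(-yz)-H_{B/I_{\langle j\rangle}}(-yz)\bigr)+(1+yz)^e\sum_{j\in\mathbb J}(-z)^{-j}\,n_{j-1}\,(-yz)^{j-1}.$$ -/

import Mathlib

open scoped LaurentPolynomial LaurentSeries PowerSeries

attribute [local instance] MvPolynomial.gradedAlgebra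

namespace GradedPoly

section Grading

variable {σ k : Type*} [Field k]

/-- `B_j`: the `k`-space of homogeneous polynomials of degree `j`, for `j : ℤ` (zero if `j < 0`). -/
def degPart (σ k : Type*) [Field k] (j : ℤ) : Submodule k (MvPolynomial σ k) where
  carrier := {f | ∀ m : σ →₀ ℕ, MvPolynomial.coeff m f ≠ 0 → (m.degree : ℤ) = j}
  zero_mem' := fun m hm => absurd (MvPolynomial.coeff_zero m) hm
  add_mem' := by
    intro f g hf hg m hm
    by_cases h : MvPolynomial.coeff m f = 0
    · refine hg m fun h' => hm ?_
      rw [MvPolynomial.coeff_add, h, h', add_zero]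
    · exact hf m h
  smul_mem' := by
    intro c f hf m hm
    refine hf m fun h' => hm ?_
    rw [MvPolynomial.coeff_smul, h', smul_zero]

theorem mem_degPart {j : ℤ} {f : MvPolynomial σ k} :
    f ∈ degPart σ k j ↔ ∀ m : σ →₀ ℕ, MvPolynomial.coeff m f ≠ 0 → (m.degree : ℤ) = j :=
  Iff.rfl

theorem degPart_natCast (n : ℕ) :
    degPart σ k (n : ℤ) = MvPolynomial.homogeneousSubmodule σ k n := by
  ext f
  rw [mem_degPart, MvPolynomial.mem_homogeneousSubmodule]
  constructor
  · intro h m hm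
    have := h m hm
    have e : Finsupp.weight (1 : σ → ℕ) m = m.degree :=
      (DFunLike.congr_fun (Finsupp.degree_eq_weight_one (R := ℕ)) m).symm
    rw [e]
    exact_mod_cast this
  · intro h m hm
    by_contra hne
    exact hm (h.coeff_eq_zero (by exact_mod_cast hne))

theorem degPart_of_neg {j : ℤ} (hj : j < 0) : degPart σ k j = ⊥ := by
  rw [eq_bot_iff]
  intro f hf
  rw [Submodule.mem_bot]
  ext m
  by_contra hm
  have := hf m (by simpa using hm)
  omega

theorem isHomogeneousElem_of_mem_degPart {j : ℤ} {f : MvPolynomial σ k}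
    (hf : f ∈ degPart σ k j) :
    SetLike.IsHomogeneousElem (MvPolynomial.homogeneousSubmodule σ k) f := by
  rcases lt_or_ge j 0 with hj | hj
  · rw [degPart_of_neg hj, Submodule.mem_bot] at hf
    exact ⟨0, hf ▸ Submodule.zero_mem _⟩
  · lift j to ℕ using hj
    exact ⟨j, degPart_natCast (σ := σ) (k := k) j ▸ hf⟩

/-- The projection of a polynomial to its component of degree `j : ℤ`. -/
noncomputable def degProj (j : ℤ) (f : MvPolynomial σ k) : MvPolynomial σ k :=
  ∑ m ∈ f.support with (m.degree : ℤ) = j, MvPolynomial.monomial m (MvPolynomial.coeff m f)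

theorem coeff_degProj (j : ℤ) (f : MvPolynomial σ k) (m : σ →₀ ℕ) :
    MvPolynomial.coeff m (degProj j f) =
      if (m.degree : ℤ) = j then MvPolynomial.coeff m f else 0 := by
  classical
  unfold degProj
  rw [MvPolynomial.coeff_sum]
  simp only [MvPolynomial.coeff_monomial]
  rw [Finset.sum_ite_eq' (Finset.filter (fun m : σ →₀ ℕ => (m.degree : ℤ) = j) f.support) m]
  by_cases h : (m.degree : ℤ) = j
  · by_cases h' : MvPolynomial.coeff m f = 0 <;> simp [h, h']
  · simp [h]

theorem degProj_mem (j : ℤ) (f : MvPolynomial σ k) : degProj j f ∈ degPart σ k j := by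
  intro m hm
  rw [coeff_degProj] at hm
  by_contra h
  exact hm (if_neg h)

theorem degProj_sum {ι : Type*} (s : Finset ι) (j : ℤ) (f : ι → MvPolynomial σ k) :
    degProj j (∑ i ∈ s, f i) = ∑ i ∈ s, degProj j (f i) := by
  ext m
  simp only [coeff_degProj, MvPolynomial.coeff_sum]
  split_ifs <;> simp

theorem degProj_mul {c j : ℤ} {p : MvPolynomial σ k} (hp : p ∈ degPart σ k c)
    (f : MvPolynomial σ k) : degProj j (p * f) = p * degProj (j - c) f := by
  classical
  ext m
  rw [coeff_degProj, MvPolynomial.coeff_mul, MvPolynomial.coeff_mul]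
  have key : ∀ x ∈ Finset.HasAntidiagonal.antidiagonal m,
      MvPolynomial.coeff x.1 p * MvPolynomial.coeff x.2 (degProj (j - c) f) =
        if (m.degree : ℤ) = j then MvPolynomial.coeff x.1 p * MvPolynomial.coeff x.2 f
        else 0 := by
    intro x hx
    by_cases h0 : MvPolynomial.coeff x.1 p = 0
    · simp [h0]
    · have h1 := hp x.1 h0
      have h2 : m.degree = x.1.degree + x.2.degree := by
        rw [← Finset.HasAntidiagonal.mem_antidiagonal.mp hx, map_add]
      rw [coeff_degProj]
      have h3 : ((x.2.degree : ℤ) = j - c) ↔ ((m.degree : ℤ) = j) := by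
        rw [h2]; push_cast; omega
      simp only [h3]
      split_ifs <;> simp
  rw [Finset.sum_congr rfl key]
  split_ifs <;> simp

theorem sum_degProj (f : MvPolynomial σ k) (S : Finset ℤ)
    (hS : ∀ m ∈ f.support, (m.degree : ℤ) ∈ S) : ∑ j ∈ S, degProj j f = f := by
  ext m
  rw [MvPolynomial.coeff_sum]
  simp only [coeff_degProj]
  rw [Finset.sum_ite_eq S (m.degree : ℤ)]
  by_cases h : m ∈ f.support
  · rw [if_pos (hS m h)]
  · rw [MvPolynomial.notMem_support_iff] at h
    simp [h]

end Grading

section Resolution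

variable {σ k : Type*} [Field k]

/-- A resolution of the ideal `I` of `B` by finitely generated graded free `B`-modules
`F_n = ⨁_a B(-deg n a)`, where `a` runs over `Fin (rank n)`. The homomorphisms, all of degree zero,
are given by matrices: `gen` defines the augmentation `F_0 → I`, and `diff n` the differential
`F_{n+1} → F_n`. -/
structure GradedFreeResolution (I : Ideal (MvPolynomial σ k)) where
  /-- the rank of `F_n` -/
  rank : ℕ → ℕ
  /-- the degrees of the basis elements of `F_n` -/
  deg : (n : ℕ) → Fin (rank n) → ℤ
  /-- the images in `I` of the basis elements of `F_0` -/
  gen : Fin (rank 0) → MvPolynomial σ k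
  /-- the matrix of `F_{n+1} → F_n` -/
  diff : (n : ℕ) → Matrix (Fin (rank n)) (Fin (rank (n + 1))) (MvPolynomial σ k)
  gen_mem : ∀ a, gen a ∈ degPart σ k (deg 0 a)
  diff_mem : ∀ n a b, diff n a b ∈ degPart σ k (deg (n + 1) b - deg n a)
  span_gen : Ideal.span (Set.range gen) = I
  exact_zero : LinearMap.range (diff 0).mulVecLin =
    LinearMap.ker (Fintype.linearCombination (MvPolynomial σ k) gen)
  exact_succ : ∀ n, LinearMap.range (diff (n + 1)).mulVecLin = LinearMap.ker (diff n).mulVecLin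

/-- A submodule of `⨁_a B(-d a)` that is generated by homogeneous elements. -/
def IsHomSub {r : ℕ} (d : Fin r → ℤ) (N : Submodule (MvPolynomial σ k) (Fin r → MvPolynomial σ k)) :
    Prop :=
  Submodule.span (MvPolynomial σ k) {v | v ∈ N ∧ ∃ j : ℤ, ∀ a, v a ∈ degPart σ k (j - d a)} = N

theorem exists_cover [Finite σ] {r : ℕ} {d : Fin r → ℤ}
    {N : Submodule (MvPolynomial σ k) (Fin r → MvPolynomial σ k)} (hN : IsHomSub d N) :
    ∃ (r' : ℕ) (d' : Fin r' → ℤ) (M : Matrix (Fin r) (Fin r') (MvPolynomial σ k)),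
      (∀ a b, M a b ∈ degPart σ k (d' b - d a)) ∧ LinearMap.range M.mulVecLin = N := by
  have hfg : (Submodule.span (MvPolynomial σ k)
      {v | v ∈ N ∧ ∃ j : ℤ, ∀ a, v a ∈ degPart σ k (j - d a)}).FG := IsNoetherian.noetherian _
  obtain ⟨s, hs, hspan⟩ := (Submodule.fg_span_iff_fg_span_finset_subset _).mp hfg
  have hdeg : ∀ b : Fin s.card, ∃ j : ℤ, ∀ a, (s.equivFin.symm b : Fin r → MvPolynomial σ k) a ∈
      degPart σ k (j - d a) := fun b => (hs (s.equivFin.symm b).2).2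
  choose d' hd' using hdeg
  refine ⟨s.card, d', Matrix.of fun a b => (s.equivFin.symm b : Fin r → MvPolynomial σ k) a,
    fun a b => hd' b a, ?_⟩
  rw [Matrix.range_mulVecLin]
  have hr : Set.range (Matrix.of fun a b =>
      (s.equivFin.symm b : Fin r → MvPolynomial σ k) a).col =
      (s : Set (Fin r → MvPolynomial σ k)) := by
    ext v
    constructor
    · rintro ⟨b, rfl⟩
      exact (s.equivFin.symm b).2
    · intro hv
      exact ⟨s.equivFin ⟨v, hv⟩, by ext1 a; simp [Matrix.col]⟩
  rw [hr, ← hspan]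
  exact hN

theorem isHomSub_of_degProj {r : ℕ} {d : Fin r → ℤ}
    {N : Submodule (MvPolynomial σ k) (Fin r → MvPolynomial σ k)}
    (h : ∀ v ∈ N, ∀ j : ℤ, (fun a => degProj (j - d a) (v a)) ∈ N) : IsHomSub d N := by
  classical
  refine le_antisymm (Submodule.span_le.mpr fun v hv => hv.1) fun v hv => ?_
  let S : Finset ℤ := Finset.univ.biUnion fun a : Fin r =>
    (v a).support.image fun m : σ →₀ ℕ => (m.degree : ℤ) + d a
  have hv' : v = ∑ j ∈ S, fun a => degProj (j - d a) (v a) := by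
    ext1 a
    rw [Finset.sum_apply]
    have := sum_degProj (v a) (S.image fun j => j - d a) (by
      intro m hm
      refine Finset.mem_image.mpr ⟨(m.degree : ℤ) + d a, ?_, by ring⟩
      exact Finset.mem_biUnion.mpr ⟨a, Finset.mem_univ _, Finset.mem_image_of_mem _ hm⟩)
    rw [Finset.sum_image (fun x _ y _ hxy => by simpa using hxy)] at this
    exact this.symm
  rw [hv']
  exact Submodule.sum_mem _ fun j _ =>
    Submodule.subset_span ⟨h v hv j, j, fun a => degProj_mem _ _⟩

theorem isHomSub_ker {r r' : ℕ} {d : Fin r → ℤ} {d' : Fin r' → ℤ}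
    {M : Matrix (Fin r) (Fin r') (MvPolynomial σ k)}
    (hM : ∀ a b, M a b ∈ degPart σ k (d' b - d a)) :
    IsHomSub d' (LinearMap.ker M.mulVecLin) := by
  refine isHomSub_of_degProj fun v hv j => ?_
  rw [LinearMap.mem_ker, Matrix.mulVecLin_apply] at hv ⊢
  ext1 a
  have h1 : ∑ b, M a b * v b = 0 := congrFun hv a
  change ∑ b, M a b * degProj (j - d' b) (v b) = 0
  have h2 : ∀ b, M a b * degProj (j - d' b) (v b) = degProj (j - d a) (M a b * v b) := by
    intro b
    rw [degProj_mul (hM a b)]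
    congr 2
    ring
  simp only [h2]
  rw [← degProj_sum, h1]
  simp [degProj]

/-- One step of the construction of a resolution: a graded free module and a homogeneous
submodule. -/
structure Stage (σ k : Type*) [Field k] where
  r : ℕ
  d : Fin r → ℤ
  N : Submodule (MvPolynomial σ k) (Fin r → MvPolynomial σ k)
  hom : IsHomSub d N

/-- A free cover of the submodule of a stage, together with its kernel, forms the next stage. -/
noncomputable def Stage.next [Finite σ] (S : Stage σ k) : Stage σ k where
  r := (exists_cover S.hom).choose
  d := (exists_cover S.hom).choose_spec.choose
  N := LinearMap.ker (exists_cover S.hom).choose_spec.choose_spec.choose.mulVecLin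
  hom := isHomSub_ker (exists_cover S.hom).choose_spec.choose_spec.choose_spec.1

theorem Stage.exists_matrix [Finite σ] (S : Stage σ k) :
    ∃ M : Matrix (Fin S.r) (Fin S.next.r) (MvPolynomial σ k),
      (∀ a b, M a b ∈ degPart σ k (S.next.d b - S.d a)) ∧
        LinearMap.range M.mulVecLin = S.N ∧ LinearMap.ker M.mulVecLin = S.next.N :=
  ⟨(exists_cover S.hom).choose_spec.choose_spec.choose,
    (exists_cover S.hom).choose_spec.choose_spec.choose_spec.1,
    (exists_cover S.hom).choose_spec.choose_spec.choose_spec.2, rfl⟩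

theorem degProj_mem_of_mem (I : HomogeneousIdeal (MvPolynomial.homogeneousSubmodule σ k))
    {p : MvPolynomial σ k} (hp : p ∈ I.toIdeal) (j : ℤ) : degProj j p ∈ I.toIdeal := by
  rcases lt_or_ge j 0 with hj | hj
  · have h := degProj_mem j p
    rw [degPart_of_neg hj, Submodule.mem_bot] at h
    rw [h]
    exact Submodule.zero_mem _
  · lift j to ℕ using hj
    have h : degProj (j : ℤ) p = MvPolynomial.homogeneousComponent j p := by
      ext m
      rw [coeff_degProj, MvPolynomial.coeff_homogeneousComponent]
      simp only [Nat.cast_inj]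
    rw [h]
    exact MvPolynomial.homogeneousComponent_mem_of_mem I.isHomogeneous hp j

/-- Every homogeneous ideal has a resolution by finitely generated graded free modules. -/
theorem nonempty_gradedFreeResolution [Finite σ]
    (I : HomogeneousIdeal (MvPolynomial.homogeneousSubmodule σ k)) :
    Nonempty (GradedFreeResolution I.toIdeal) := by
  have hI : IsHomSub (fun _ : Fin 1 => (0 : ℤ))
      (Submodule.comap (LinearMap.proj (R := MvPolynomial σ k)
        (φ := fun _ : Fin 1 => MvPolynomial σ k) 0) I.toIdeal) := by
    refine isHomSub_of_degProj fun v hv j => ?_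
    exact degProj_mem_of_mem I hv _
  let S : ℕ → Stage σ k := fun n => Nat.rec ⟨1, fun _ => 0, _, hI⟩ (fun _ T => T.next) n
  choose M hM hrange hker using fun n => (S n).exists_matrix
  have hlin : ∀ v, (M 0).mulVecLin v =
      fun _ => Fintype.linearCombination (MvPolynomial σ k) (fun a => M 0 0 a) v := by
    intro v
    ext1 i
    have hi : i = (0 : Fin 1) := Subsingleton.elim (α := Fin 1) i 0
    subst hi
    simp [Fintype.linearCombination_apply, Matrix.mulVec, dotProduct, mul_comm]
  exact ⟨{
    rank := fun n => (S (n + 1)).r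
    deg := fun n => (S (n + 1)).d
    gen := fun a => M 0 0 a
    diff := fun n => M (n + 1)
    gen_mem := fun a => by
      have h := hM 0 0 a
      rwa [show (S 0).d 0 = 0 from rfl, sub_zero] at h
    diff_mem := fun n a b => hM (n + 1) a b
    span_gen := by
      rw [Ideal.span, ← Fintype.range_linearCombination]
      ext p
      have h : (fun _ : Fin 1 => p) ∈ LinearMap.range (M 0).mulVecLin ↔ p ∈ I.toIdeal := by
        rw [hrange 0]
        exact Iff.rfl
      rw [← h]
      constructor
      · rintro ⟨v, rfl⟩
        exact ⟨v, hlin v⟩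
      · rintro ⟨v, hv⟩
        exact ⟨v, congrFun ((hlin v).symm.trans hv) 0⟩
    exact_zero := by
      refine ((hrange 1).trans (hker 0).symm).trans ?_
      ext v
      rw [LinearMap.mem_ker, LinearMap.mem_ker, hlin]
      exact ⟨fun h => congrFun h 0, fun h => funext fun _ => h⟩
    exact_succ := fun n => (hrange (n + 2)).trans (hker (n + 1)).symm }⟩

end Resolution

section CoefficientRing

/-- The ring `ℤ[y^{±1}]` of Laurent polynomials in `y`. -/
def ZY : Type := ℤ[T;T⁻¹]

noncomputable instance : CommRing ZY := inferInstanceAs (CommRing ℤ[T;T⁻¹])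

/-- The variable `y`, a unit of `ℤ[y^{±1}]`. -/
noncomputable def y : ZYˣ where
  val := (LaurentPolynomial.T 1 : ℤ[T;T⁻¹])
  inv := (LaurentPolynomial.T (-1) : ℤ[T;T⁻¹])
  val_inv := (LaurentPolynomial.T_add (R := ℤ) 1 (-1)).symm.trans LaurentPolynomial.T_zero
  inv_val := (LaurentPolynomial.T_add (R := ℤ) (-1) 1).symm.trans LaurentPolynomial.T_zero

end CoefficientRing

section Betti

variable {σ k : Type*} [Field k]

/-- The matrix over `k` of the map `F_{n+1} ⊗_B k → F_n ⊗_B k`, where `k = B/(B_1)` and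
`F_n ⊗_B k` is identified with `k ^ rank n`. -/
noncomputable def GradedFreeResolution.diffBar {I : Ideal (MvPolynomial σ k)}
    (F : GradedFreeResolution I) (n : ℕ) : Matrix (Fin (F.rank n)) (Fin (F.rank (n + 1))) k :=
  (F.diff n).map MvPolynomial.constantCoeff

/-- `(F_n ⊗_B k)_j`. -/
def GradedFreeResolution.tensorDeg {I : Ideal (MvPolynomial σ k)}
    (F : GradedFreeResolution I) (n : ℕ) (j : ℤ) : Submodule k (Fin (F.rank n) → k) where
  carrier := {v | ∀ a, v a ≠ 0 → F.deg n a = j}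
  zero_mem' := fun _ h => absurd rfl h
  add_mem' := by
    intro v w hv hw a ha
    by_cases h : v a = 0
    · exact hw a fun h' => ha (by simp [h, h'])
    · exact hv a h
  smul_mem' := by
    intro c v hv a ha
    exact hv a fun h => ha (by simp [h])

/-- The `n`-cycles of the complex `F ⊗_B k`. -/
noncomputable def GradedFreeResolution.cycles {I : Ideal (MvPolynomial σ k)}
    (F : GradedFreeResolution I) : (n : ℕ) → Submodule k (Fin (F.rank n) → k)
  | 0 => ⊤
  | n + 1 => LinearMap.ker (F.diffBar n).mulVecLin

/-- The `n`-boundaries of the complex `F ⊗_B k`. -/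
noncomputable def GradedFreeResolution.boundaries {I : Ideal (MvPolynomial σ k)}
    (F : GradedFreeResolution I) (n : ℕ) : Submodule k (Fin (F.rank n) → k) :=
  LinearMap.range (F.diffBar n).mulVecLin

/-- `Tor_i^B(I, k)_j`: the degree `j` part of the `i`-th homology of `F ⊗_B k`. -/
abbrev GradedFreeResolution.TorPart {I : Ideal (MvPolynomial σ k)}
    (F : GradedFreeResolution I) (i : ℕ) (j : ℤ) : Type _ :=
  ↥(F.cycles i ⊓ F.tensorDeg i j) ⧸
    (F.boundaries i ⊓ F.tensorDeg i j).submoduleOf (F.cycles i ⊓ F.tensorDeg i j)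

variable [Finite σ]

/-- The graded Betti number `β_{i,j}^B(I) = rank_k Tor_i^B(I, k)_j`, computed from a resolution
of `I` by finitely generated graded free modules (it does not depend on the resolution). -/
noncomputable def gradedBetti (I : HomogeneousIdeal (MvPolynomial.homogeneousSubmodule σ k))
    (i : ℕ) (j : ℤ) : ℕ :=
  Module.finrank k ((nonempty_gradedFreeResolution I).some.TorPart i j)

theorem finite_support_gradedBetti
    (I : HomogeneousIdeal (MvPolynomial.homogeneousSubmodule σ k)) (i : ℕ) :
    (Function.support fun j => gradedBetti I i j).Finite := by
  refine (Set.finite_range ((nonempty_gradedFreeResolution I).some.deg i)).subset fun j hj => ?_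
  by_contra hne
  refine hj ?_
  have hz : (nonempty_gradedFreeResolution I).some.tensorDeg i j = ⊥ := by
    rw [eq_bot_iff]
    intro v hv
    rw [Submodule.mem_bot]
    ext1 a
    by_contra ha
    exact hne ⟨a, hv a ha⟩
  have hz' : Subsingleton ↥((nonempty_gradedFreeResolution I).some.cycles i ⊓
      (nonempty_gradedFreeResolution I).some.tensorDeg i j) := by
    rw [hz, inf_bot_eq]
    infer_instance
  exact Module.finrank_zero_of_subsingleton

/-- The coefficient `∑_j β_{i,j}^B(I) y^j` of `z^i` in the graded Poincaré series. -/
noncomputable def poincareCoeff (I : HomogeneousIdeal (MvPolynomial.homogeneousSubmodule σ k))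
    (i : ℕ) : ZY :=
  ∑ j ∈ (finite_support_gradedBetti I i).toFinset, (gradedBetti I i j : ZY) * ((y ^ j : ZYˣ) : ZY)

/-- The graded Poincaré series `P^B_I(y, z) = ∑_i ∑_j β_{i,j}^B(I) y^j z^i`, a power series in `z`
over `ℤ[y^{±1}]`. -/
noncomputable def poincareSeries
    (I : HomogeneousIdeal (MvPolynomial.homogeneousSubmodule σ k)) : ZY⟦X⟧ :=
  PowerSeries.mk (poincareCoeff I)

/-- `I` is `t`-linear: `β_{i,j}^B(I) = 0` for `j ≠ i + t`. -/
def IsLinear (t : ℤ) (I : HomogeneousIdeal (MvPolynomial.homogeneousSubmodule σ k)) : Prop :=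
  ∀ (i : ℕ) (j : ℤ), j ≠ i + t → gradedBetti I i j = 0

end Betti

section Component

variable {σ k : Type*} [Field k]

/-- `I_j = I ∩ B_j`. -/
noncomputable def component (I : HomogeneousIdeal (MvPolynomial.homogeneousSubmodule σ k)) (j : ℤ) :
    Submodule k (MvPolynomial σ k) :=
  I.toIdeal.restrictScalars k ⊓ degPart σ k j

/-- The homogeneous ideal `I_{⟨j⟩} = B I_j`. -/
noncomputable def componentIdeal (I : HomogeneousIdeal (MvPolynomial.homogeneousSubmodule σ k)) (j : ℤ) :
    HomogeneousIdeal (MvPolynomial.homogeneousSubmodule σ k) :=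
  ⟨Ideal.span (component I j : Set (MvPolynomial σ k)),
    Ideal.homogeneous_span _ _ fun _ hf => isHomogeneousElem_of_mem_degPart hf.2⟩

/-- `I` is componentwise linear: `B I_j` is `j`-linear for every `j`. -/
def IsComponentwiseLinear [Finite σ]
    (I : HomogeneousIdeal (MvPolynomial.homogeneousSubmodule σ k)) : Prop :=
  ∀ j : ℤ, IsLinear j (componentIdeal I j)

/-- `n_j = rank_k I_j`. -/
noncomputable def componentRank
    (I : HomogeneousIdeal (MvPolynomial.homogeneousSubmodule σ k)) (j : ℤ) : ℕ :=
  Module.finrank k (component I j)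

/-- The set `𝕁` of the integers `j` with `I_j ≠ B_1 I_{j-1}`. -/
def generatorDegrees (I : HomogeneousIdeal (MvPolynomial.homogeneousSubmodule σ k)) : Set ℤ :=
  {j | component I j ≠ degPart σ k 1 * component I (j - 1)}

/-- The Hilbert series `H_{B/I}(u) = ∑_n rank_k (B/I)_n u^n`, where `(B/I)_n` is the image
of `B_n`. -/
noncomputable def hilbertSeries
    (I : HomogeneousIdeal (MvPolynomial.homogeneousSubmodule σ k)) : ℤ⟦X⟧ :=
  PowerSeries.mk fun n : ℕ => (Module.finrank k ((degPart σ k n).map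
    (Ideal.Quotient.mkₐ k I.toIdeal).toLinearMap) : ℤ)

end Component

section Series

/-- The variable `z`, a unit of the ring `ℤ[y^{±1}]((z))` of Laurent series in `z`. -/
noncomputable def z : (ZY⸨X⸩)ˣ where
  val := HahnSeries.single 1 1
  inv := HahnSeries.single (-1) 1
  val_inv := by simp
  inv_val := by simp

/-- The monomial `yz`, a unit of the ring `ℤ[y^{±1}]((z))`. -/
noncomputable def yz : (ZY⸨X⸩)ˣ where
  val := HahnSeries.single 1 (y : ZY)
  inv := HahnSeries.single (-1) ((y⁻¹ : ZYˣ) : ZY)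
  val_inv := by simp
  inv_val := by simp

/-- `H(-yz)` in `ℤ[y^{±1}]((z))`, for a power series `H(u)` with integer coefficients. -/
noncomputable def substNegYZ (H : ℤ⟦X⟧) : ZY⸨X⸩ :=
  HahnSeries.ofPowerSeries ℤ ZY
    (PowerSeries.rescale (-(y : ZY)) (PowerSeries.map (Int.castRingHom ZY) H))

end Series

end GradedPoly

/-! Tor is balanced, so the Betti numbers of `I` are the homology ranks of the Koszul complex `K` of
the variables with coefficients in `I`. In the strand `K_{i+1} ⊗ I_{j-1} → K_i ⊗ I_j`, let `z_{i,j}`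
be the rank of the cycles in `K_i ⊗ I_j`. Rank-nullity gives `β_{i,i+j}(I) = z_{i,j} + z_{i+1,j-1} -
C(e,i+1) n_{j-1}` (`gradedBetti_add`).

The decisive point is that `z_{i,j}` depends on the vector space `I_j` alone, so it may be computed
from `I_⟨j⟩`. As `I_⟨j⟩` vanishes below degree `j`, the same formula gives `z_{i,j} =
β_{i,i+j}(I_⟨j⟩)`. When `I_⟨j⟩` is `j`-linear, these are its only possibly nonzero Betti numbers,
and they are read off, up to the sign `(-1)^i`, from `(1-u)^e` times its Hilbert series
(`coeff_idealSeries_of_eq`). Substitution into the formula yields the generating function of each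
strand `β_{i,i+j}(I)`, `i ≥ 0` (`one_sub_X_pow_mul_eq`).

If `j` is not in `𝕁`, then `I` and `I_⟨j-1⟩` agree in degrees `j-1` and `j`, so `β_{i,i+j}(I)`
equals a Betti number of a `(j-1)`-linear ideal lying off its linear strand, hence zero
(`gradedBetti_eq_zero_of_notMem`). Only strands with `j ∈ 𝕁` remain; putting `u = -yz` and
multiplying by `(-z)^{-j}` restores the right monomials.

Balance (`finrank_torPart`) is proved by dimension shifting along the given resolution, using an
explicit contracting homotopy of the Koszul complex of `k[X]`. -/

set_option linter.unusedSectionVars false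

namespace GradedPoly

/-! ### The Koszul complex. -/

section Koszul

variable {σ k : Type*} [Field k] [LinearOrder σ]

/-- The coefficient `± X_x` of `e_{S ∪ {x}} ↦ e_S` in the differential of the Koszul complex. -/
noncomputable def koszulCoeff (k : Type*) [Field k] (x : σ) (S : Finset σ) : MvPolynomial σ k :=
  MvPolynomial.monomial (Finsupp.single x 1) ((-1) ^ (S.filter (· < x)).card)

/-- Inserting the smaller `x` adds one element below `y`, while inserting `y` adds none below `x`;
exactly one of the two signs flips. -/
theorem koszulCoeff_mul_insert_of_lt {x y : σ} {S : Finset σ} (hx : x ∉ S) (hxy : x < y) :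
    koszulCoeff k x S * koszulCoeff k y (insert x S) =
      -(koszulCoeff k y S * koszulCoeff k x (insert y S)) := by
  have h1 : (insert x S).filter (· < y) = insert x (S.filter (· < y)) := by
    rw [Finset.filter_insert, if_pos hxy]
  have h2 : (insert y S).filter (· < x) = S.filter (· < x) := by
    rw [Finset.filter_insert, if_neg hxy.not_gt]
  simp only [koszulCoeff, MvPolynomial.monomial_mul, ← map_neg, h1, h2]
  rw [Finset.card_insert_of_notMem (by simp [hx]), add_comm (Finsupp.single x 1)]
  congr 1
  ring

theorem koszulCoeff_mul_insert {x y : σ} {S : Finset σ} (hx : x ∉ S) (hy : y ∉ S) (hxy : x ≠ y) :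
    koszulCoeff k x S * koszulCoeff k y (insert x S) =
      -(koszulCoeff k y S * koszulCoeff k x (insert y S)) := by
  rcases lt_or_gt_of_ne hxy with h | h
  · exact koszulCoeff_mul_insert_of_lt hx h
  · rw [koszulCoeff_mul_insert_of_lt hy h, neg_neg]

variable [Fintype σ]
variable {M : Type*} [AddCommGroup M] [Module (MvPolynomial σ k) M]

variable (k M) in
/-- The differential of the Koszul complex of `X_1, …, X_e` with coefficients in `M`; a chain is
given by its coefficients with respect to the basis elements `e_S`. -/
noncomputable def koszulD : (Finset σ → M) →ₗ[MvPolynomial σ k] (Finset σ → M) :=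
  LinearMap.pi fun S => ∑ x ∈ Sᶜ, koszulCoeff k x S • LinearMap.proj (insert x S)

theorem koszulD_apply (c : Finset σ → M) (S : Finset σ) :
    koszulD k M c S = ∑ x ∈ Sᶜ, koszulCoeff k x S • c (insert x S) := by
  simp [koszulD]

theorem koszulD_koszulD (c : Finset σ → M) : koszulD k M (koszulD k M c) = 0 := by
  ext1 S
  simp only [koszulD_apply, Finset.smul_sum, smul_smul, Pi.zero_apply]
  rw [Finset.sum_sigma']
  refine Finset.sum_involution (fun a _ => ⟨a.2, a.1⟩) ?_ ?_ ?_ ?_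
  · rintro ⟨x, y⟩ h
    simp only [Finset.mem_sigma, Finset.mem_compl, Finset.mem_insert, not_or] at h
    dsimp only
    rw [koszulCoeff_mul_insert h.1 h.2.2 (Ne.symm h.2.1), neg_smul, Finset.insert_comm y x,
      neg_add_cancel]
  · rintro ⟨x, y⟩ h _ he
    simp only [Finset.mem_sigma, Finset.mem_compl, Finset.mem_insert, not_or] at h
    simp only [Sigma.mk.injEq, heq_eq_eq] at he
    exact h.2.1 he.1
  · rintro ⟨x, y⟩ h
    simp only [Finset.mem_sigma, Finset.mem_compl, Finset.mem_insert, not_or] at h ⊢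
    exact ⟨h.2.2, Ne.symm h.2.1, h.1⟩
  · rintro ⟨x, y⟩ h
    rfl

theorem koszulD_map {M' : Type*} [AddCommGroup M'] [Module (MvPolynomial σ k) M']
    (φ : M →ₗ[MvPolynomial σ k] M') (c : Finset σ → M) :
    koszulD k M' (φ.compLeft (Finset σ) c) = φ.compLeft (Finset σ) (koszulD k M c) := by
  ext1 S
  simp [koszulD_apply]

end Koszul

/-! ### Acyclicity of the Koszul complex of `k[X]`. -/

section Exactness

variable {σ k : Type*} [Field k] [LinearOrder σ]

/-- The quotient by `X_t` of the part of `f` consisting of the terms that involve only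
variables `X_s` with `t ≤ s`. -/
noncomputable def divTail (t : σ) (f : MvPolynomial σ k) : MvPolynomial σ k :=
  MvPolynomial.divMonomial (∑ m ∈ f.support with ∀ s ∈ m.support, t ≤ s,
    MvPolynomial.monomial m (MvPolynomial.coeff m f)) (Finsupp.single t 1)

theorem coeff_divTail (t : σ) (f : MvPolynomial σ k) (m : σ →₀ ℕ) :
    MvPolynomial.coeff m (divTail t f) =
      if ∀ s ∈ m.support, t ≤ s then MvPolynomial.coeff (Finsupp.single t 1 + m) f else 0 := by
  unfold divTail
  rw [MvPolynomial.coeff_divMonomial, MvPolynomial.coeff_sum]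
  simp only [MvPolynomial.coeff_monomial]
  rw [Finset.sum_ite_eq' _ (Finsupp.single t 1 + m)]
  have h : (∀ s ∈ (Finsupp.single t 1 + m).support, t ≤ s) ↔ ∀ s ∈ m.support, t ≤ s := by
    constructor
    · intro h s hs
      exact h s (by simp only [Finsupp.mem_support_iff, Finsupp.add_apply] at hs ⊢; omega)
    · intro h s hs
      by_cases hst : t = s
      · exact hst.le
      · refine h s ?_
        simp only [Finsupp.mem_support_iff, Finsupp.add_apply, Finsupp.single_apply,
          if_neg hst] at hs ⊢
        omega
  by_cases h' : ∀ s ∈ m.support, t ≤ s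
  · rw [if_pos h']
    by_cases h0 : MvPolynomial.coeff (Finsupp.single t 1 + m) f = 0
    · rw [h0]; split_ifs <;> rfl
    · rw [if_pos]
      rw [Finset.mem_filter, MvPolynomial.mem_support_iff]
      exact ⟨h0, h.mpr h'⟩
  · rw [if_neg h', if_neg]
    rw [Finset.mem_filter, not_and]
    exact fun _ h'' => h' (h.mp h'')

theorem divTail_mem {t : σ} {f : MvPolynomial σ k} {j : ℤ} (hf : f ∈ degPart σ k j) :
    divTail t f ∈ degPart σ k (j - 1) := by
  intro m hm
  rw [coeff_divTail] at hm
  have h := hf (Finsupp.single t 1 + m) (fun h => hm (by rw [h]; split_ifs <;> rfl))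
  rw [map_add, Finsupp.degree_single] at h
  push_cast at h
  omega

theorem divTail_zero (t : σ) : divTail t (0 : MvPolynomial σ k) = 0 := by
  simp [divTail]

/-- A contracting homotopy of the Koszul complex of `k[X]`. -/
noncomputable def koszulHomotopy (c : Finset σ → MvPolynomial σ k) (S : Finset σ) :
    MvPolynomial σ k :=
  if h : S.Nonempty then divTail (S.min' h) (c (S.erase (S.min' h))) else 0

theorem koszulHomotopy_of_isLeast {c : Finset σ → MvPolynomial σ k} {S : Finset σ} {t : σ}
    (ht : t ∈ S) (hle : ∀ s ∈ S, t ≤ s) : koszulHomotopy c S = divTail t (c (S.erase t)) := by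
  have hS : S.Nonempty := ⟨t, ht⟩
  have h : S.min' hS = t := le_antisymm (S.min'_le t ht) (S.le_min' hS t hle)
  rw [koszulHomotopy, dif_pos hS, h]

variable [Fintype σ]

theorem coeff_koszulD (c : Finset σ → MvPolynomial σ k) (S : Finset σ) (m : σ →₀ ℕ) :
    MvPolynomial.coeff m (koszulD k _ c S) = ∑ x ∈ Sᶜ, if x ∈ m.support then
      (-1) ^ (S.filter (· < x)).card * MvPolynomial.coeff (m - Finsupp.single x 1) (c (insert x S))
      else 0 := by
  rw [koszulD_apply, MvPolynomial.coeff_sum]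
  refine Finset.sum_congr rfl fun x _ => ?_
  rw [koszulCoeff, smul_eq_mul, MvPolynomial.coeff_monomial_mul']
  simp [Finsupp.single_le_iff, Nat.one_le_iff_ne_zero]

/-- The homotopy moves the least index `t` occurring in a term `X^m e_S` from the monomial into `S`,
and kills the term if `t` is already in `S`. The identity is checked at each `(S, m)`, where `t` is
the least element of `m.support ∪ S`. The only term without such a `t` is the constant term at
`e_∅`, which is why `h0` is needed. -/
theorem koszulD_koszulHomotopy {c : Finset σ → MvPolynomial σ k} (hc : koszulD k _ c = 0)
    (h0 : MvPolynomial.constantCoeff (c ∅) = 0) : koszulD k _ (koszulHomotopy c) = c := by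
  ext S m
  rw [coeff_koszulD]
  by_cases hU : (m.support ∪ S).Nonempty
  swap
  · rw [Finset.not_nonempty_iff_eq_empty, Finset.union_eq_empty] at hU
    obtain ⟨hm, rfl⟩ := hU
    rw [Finset.sum_eq_zero]
    · rw [Finsupp.support_eq_empty] at hm
      rw [hm]
      exact h0.symm
    · intro x _
      rw [hm, if_neg (by simp)]
  obtain ⟨t, htU, htle⟩ : ∃ t ∈ m.support ∪ S, ∀ s ∈ m.support ∪ S, t ≤ s :=
    ⟨_, Finset.min'_mem _ hU, fun s hs => Finset.min'_le _ s hs⟩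
  have htm : ∀ s ∈ m.support, t ≤ s := fun s hs => htle s (Finset.mem_union_left _ hs)
  have htS : ∀ s ∈ S, t ≤ s := fun s hs => htle s (Finset.mem_union_right _ hs)
  have hsub : ∀ x, ∀ s ∈ (m - Finsupp.single x 1).support, s ∈ m.support := by
    intro x s hs
    simp only [Finsupp.mem_support_iff, Finsupp.tsub_apply] at hs ⊢
    omega
  by_cases ht : t ∈ S
  -- The cycle condition at `S \ {t}` and monomial `X_t X^m` has the sought coefficient as its `x =
  -- t` term. Its other terms are, up to sign, those of the differential of the homotopy.
  · have hD : MvPolynomial.coeff (Finsupp.single t 1 + m) (koszulD k _ c (S.erase t)) = 0 := by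
      rw [hc]; simp
    rw [coeff_koszulD] at hD
    have hcompl : (S.erase t)ᶜ = insert t Sᶜ := by
      ext x; simp only [Finset.mem_compl, Finset.mem_erase, Finset.mem_insert]; tauto
    rw [hcompl, Finset.sum_insert (by simpa using ht)] at hD
    have hf : (S.erase t).filter (· < t) = ∅ := by
      rw [Finset.filter_eq_empty_iff]
      intro x hx
      exact not_lt.mpr (htS x (Finset.mem_of_mem_erase hx))
    rw [if_pos (by simp), hf, Finset.insert_erase ht, add_tsub_cancel_left] at hD
    simp only [Finset.card_empty, pow_zero, one_mul] at hD
    rw [eq_neg_of_add_eq_zero_left hD, ← Finset.sum_neg_distrib]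
    refine Finset.sum_congr rfl fun x hx => ?_
    have hxS : x ∉ S := Finset.mem_compl.mp hx
    have hxt : x ≠ t := fun h => hxS (h ▸ ht)
    have hmem : x ∈ (Finsupp.single t 1 + m).support ↔ x ∈ m.support := by
      simp [hxt.symm]
    simp only [hmem]
    split_ifs with hxm
    · have htx : t < x := lt_of_le_of_ne (htm x hxm) hxt.symm
      rw [koszulHomotopy_of_isLeast (t := t) (Finset.mem_insert_of_mem ht) (by
        intro s hs
        rcases Finset.mem_insert.mp hs with rfl | hs
        · exact htx.le
        · exact htS s hs), coeff_divTail, if_pos fun s hs => htm s (hsub x s hs)]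
      have hfil : S.filter (· < x) = insert t ((S.erase t).filter (· < x)) := by
        ext s
        simp only [Finset.mem_filter, Finset.mem_insert, Finset.mem_erase]
        by_cases h : s = t
        · subst h; simp [ht, htx]
        · simp [h]
      rw [hfil, Finset.card_insert_of_notMem (by simp), Finset.erase_insert_of_ne hxt]
      have hle : Finsupp.single x 1 ≤ m := by
        rw [Finsupp.single_le_iff]
        exact Nat.one_le_iff_ne_zero.mpr (Finsupp.mem_support_iff.mp hxm)
      rw [add_tsub_assoc_of_le hle]
      ring
    · simp
  · have htm' : t ∈ m.support := by
      rcases Finset.mem_union.mp htU with h | h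
      · exact h
      · exact absurd h ht
    -- Only `x = t` contributes: for `x ≠ t` the least element of `S ∪ {x}` exceeds `t`, yet `X_t`
    -- still divides the remaining monomial, so `divTail` discards it.
    rw [Finset.sum_eq_single_of_mem t (by simpa using ht)]
    · rw [if_pos htm', koszulHomotopy_of_isLeast (t := t) (Finset.mem_insert_self _ _) (by
        intro s hs
        rcases Finset.mem_insert.mp hs with rfl | hs
        · exact le_rfl
        · exact htS s hs), coeff_divTail, if_pos fun s hs => htm s (hsub t s hs),
        Finset.erase_insert ht]
      have hf : S.filter (· < t) = ∅ := by
        rw [Finset.filter_eq_empty_iff]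
        intro x hx
        exact not_lt.mpr (htS x hx)
      have hle : Finsupp.single t 1 ≤ m := by
        rw [Finsupp.single_le_iff]
        exact Nat.one_le_iff_ne_zero.mpr (Finsupp.mem_support_iff.mp htm')
      rw [hf, add_tsub_cancel_of_le hle]
      simp
    · intro x hx hxt
      split_ifs with hxm
      · have htx : t < x := lt_of_le_of_ne (htm x hxm) hxt.symm
        have hne : (insert x S).Nonempty := Finset.insert_nonempty _ _
        rw [koszulHomotopy, dif_pos hne, coeff_divTail, if_neg, mul_zero]
        intro h
        have h1 := h t (by
          simp only [Finsupp.mem_support_iff, Finsupp.tsub_apply, Finsupp.single_apply,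
            if_neg hxt, tsub_zero] at htm' ⊢
          exact htm')
        rcases Finset.mem_insert.mp (Finset.min'_mem _ hne) with h2 | h2
        · exact absurd (h2 ▸ h1) (not_le.mpr htx)
        · exact ht (le_antisymm (htS _ h2) h1 ▸ h2)
      · rfl

end Exactness

end GradedPoly

/-! ### Comparison of subquotients. -/

namespace GradedPoly

/-- Both quotients are images of the same subspace of `X'`, under maps with the same kernel. This
takes the place of a connecting homomorphism: the isomorphism is given by the correspondence `h x ↔
v x`. -/
theorem finrank_subquotient_eq {k X Y Z : Type*} [Field k] [AddCommGroup X] [Module k X]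
    [AddCommGroup Y] [Module k Y] [AddCommGroup Z] [Module k Z] (h : X →ₗ[k] Y) (v : X →ₗ[k] Z)
    (X' : Submodule k X) {KY bY : Submodule k Y} {KZ bZ : Submodule k Z}
    (hKY : KY ≤ X'.map h) (hKZ : KZ ≤ X'.map v) (hK : ∀ x ∈ X', h x ∈ KY ↔ v x ∈ KZ)
    (hb : ∀ x ∈ X', h x ∈ KY → (h x ∈ bY ↔ v x ∈ bZ)) :
    Module.finrank k (KY ⧸ bY.submoduleOf KY) = Module.finrank k (KZ ⧸ bZ.submoduleOf KZ) := by
  let W : Submodule k X := X' ⊓ KY.comap h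
  let f : W →ₗ[k] KY := (h.comp W.subtype).codRestrict KY fun x => x.2.2
  let g : W →ₗ[k] KZ := (v.comp W.subtype).codRestrict KZ fun x => (hK _ x.2.1).mp x.2.2
  let f' := (bY.submoduleOf KY).mkQ.comp f
  let g' := (bZ.submoduleOf KZ).mkQ.comp g
  have hf : Function.Surjective f' := by
    refine (Submodule.mkQ_surjective _).comp ?_
    rintro ⟨y, hy⟩
    obtain ⟨x, hx, rfl⟩ := hKY hy
    exact ⟨⟨x, hx, hy⟩, rfl⟩
  have hg : Function.Surjective g' := by
    refine (Submodule.mkQ_surjective _).comp ?_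
    rintro ⟨y, hy⟩
    obtain ⟨x, hx, rfl⟩ := hKZ hy
    exact ⟨⟨x, hx, (hK x hx).mpr hy⟩, rfl⟩
  have hker : LinearMap.ker f' = LinearMap.ker g' := by
    ext x
    rw [LinearMap.mem_ker, LinearMap.mem_ker]
    change (bY.submoduleOf KY).mkQ (f x) = 0 ↔ (bZ.submoduleOf KZ).mkQ (g x) = 0
    rw [Submodule.mkQ_apply, Submodule.mkQ_apply, Submodule.Quotient.mk_eq_zero,
      Submodule.Quotient.mk_eq_zero]
    exact hb _ x.2.1 x.2.2
  rw [← (f'.quotKerEquivOfSurjective hf).finrank_eq, hker,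
    (g'.quotKerEquivOfSurjective hg).finrank_eq]

/-! ### Graded Koszul chains and dimension shifting. -/

section Chains

variable {σ k : Type*} [Field k]
variable {M : Type*} [AddCommGroup M] [Module k M]

/-- The chains of degree `p` of the Koszul complex with coefficients in `N_j`. -/
def koszulChain (σ : Type*) (N : ℤ → Submodule k M) (p : ℕ) (j : ℤ) :
    Submodule k (Finset σ → M) where
  carrier := {c | ∀ S, (S.card = p → c S ∈ N j) ∧ (S.card ≠ p → c S = 0)}
  zero_mem' := fun _ => ⟨fun _ => Submodule.zero_mem _, fun _ => rfl⟩
  add_mem' := by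
    intro a b ha hb S
    exact ⟨fun h => Submodule.add_mem _ ((ha S).1 h) ((hb S).1 h), fun h => by
      rw [Pi.add_apply, (ha S).2 h, (hb S).2 h, add_zero]⟩
  smul_mem' := by
    intro r c hc S
    exact ⟨fun h => Submodule.smul_mem _ r ((hc S).1 h), fun h => by
      rw [Pi.smul_apply, (hc S).2 h, smul_zero]⟩

theorem koszulChain_apply_mem {N : ℤ → Submodule k M} {p : ℕ} {j : ℤ} {c : Finset σ → M}
    (hc : c ∈ koszulChain σ N p j) (S : Finset σ) : c S ∈ N j := by
  by_cases h : S.card = p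
  · exact (hc S).1 h
  · rw [(hc S).2 h]; exact Submodule.zero_mem _

variable [Module (MvPolynomial σ k) M] [IsScalarTower k (MvPolynomial σ k) M]

/-- The family `N` of subspaces is stable under multiplication by forms of degree one. -/
def IsGradedFamily (σ : Type*) [Module (MvPolynomial σ k) M] (N : ℤ → Submodule k M) : Prop :=
  ∀ ⦃j : ℤ⦄ ⦃f : MvPolynomial σ k⦄ ⦃m : M⦄, f ∈ degPart σ k 1 → m ∈ N j → f • m ∈ N (j + 1)

theorem koszulCoeff_mem [LinearOrder σ] (x : σ) (S : Finset σ) :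
    koszulCoeff k x S ∈ degPart σ k 1 := by
  intro m hm
  rw [koszulCoeff, MvPolynomial.coeff_monomial] at hm
  split_ifs at hm with h
  · rw [← h, Finsupp.degree_single, Nat.cast_one]
  · exact absurd rfl hm

variable [LinearOrder σ] [Fintype σ]
variable {M' : Type*} [AddCommGroup M'] [Module k M'] [Module (MvPolynomial σ k) M']
  [IsScalarTower k (MvPolynomial σ k) M']
variable {M'' : Type*} [AddCommGroup M''] [Module k M''] [Module (MvPolynomial σ k) M'']
  [IsScalarTower k (MvPolynomial σ k) M'']

theorem koszulD_mem {N : ℤ → Submodule k M} (hN : IsGradedFamily σ N) {p : ℕ} {j j' : ℤ}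
    (hj : j' = j + 1) {c : Finset σ → M} (hc : c ∈ koszulChain σ N (p + 1) j) :
    koszulD k M c ∈ koszulChain σ N p j' := by
  subst hj
  intro S
  rw [koszulD_apply]
  refine ⟨fun _ => Submodule.sum_mem _ fun x _ =>
    hN (koszulCoeff_mem x S) (koszulChain_apply_mem hc _), fun h => ?_⟩
  refine Finset.sum_eq_zero fun x hx => ?_
  rw [(hc (insert x S)).2, smul_zero]
  rw [Finset.card_insert_of_notMem (by simpa using hx)]
  omega

theorem koszulD_eq_zero {N : ℤ → Submodule k M} {j : ℤ} {c : Finset σ → M}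
    (hc : c ∈ koszulChain σ N 0 j) : koszulD k M c = 0 := by
  ext1 S
  rw [koszulD_apply]
  refine Finset.sum_eq_zero fun x hx => ?_
  rw [(hc (insert x S)).2, smul_zero]
  simp

variable (k M) in
/-- The Koszul differential as a `k`-linear map. -/
noncomputable abbrev koszulDₖ : (Finset σ → M) →ₗ[k] (Finset σ → M) :=
  (koszulD k M).restrictScalars k

variable (σ) in
/-- The `k`-linear map induced on Koszul chains. -/
noncomputable abbrev chainMap (φ : M →ₗ[MvPolynomial σ k] M') :
    (Finset σ → M) →ₗ[k] (Finset σ → M') :=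
  (φ.compLeft (Finset σ)).restrictScalars k

theorem chainMap_mem {φ : M →ₗ[MvPolynomial σ k] M'} {N : ℤ → Submodule k M}
    {N' : ℤ → Submodule k M'} (hφ : ∀ j, ∀ m ∈ N j, φ m ∈ N' j) {p : ℕ} {j : ℤ}
    {c : Finset σ → M} (hc : c ∈ koszulChain σ N p j) :
    chainMap σ φ c ∈ koszulChain σ N' p j := fun S =>
  ⟨fun h => hφ j _ ((hc S).1 h), fun h => by
    change φ (c S) = 0
    rw [(hc S).2 h, map_zero]⟩

theorem exists_chain_lift {φ : M →ₗ[MvPolynomial σ k] M'} {N : ℤ → Submodule k M}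
    {p : ℕ} {j : ℤ} {c : Finset σ → M'} (hc : ∀ S, S.card = p → ∃ m ∈ N j, φ m = c S)
    (hc' : ∀ S, S.card ≠ p → c S = 0) : c ∈ (koszulChain σ N p j).map (chainMap σ φ) := by
  choose f hf hf' using hc
  refine ⟨fun S => if h : S.card = p then f S h else 0, fun S => ⟨fun h => ?_, fun h => ?_⟩, ?_⟩
  · dsimp only; rw [dif_pos h]; exact hf S h
  · dsimp only; rw [dif_neg h]
  · ext1 S
    change φ (if h : S.card = p then f S h else 0) = c S
    split_ifs with h
    · exact hf' S h
    · rw [map_zero, hc' S h]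

/-- The Koszul complex with coefficients in `N` is exact at the chains of degree `p`. -/
def RowExact (σ : Type*) [LinearOrder σ] [Fintype σ] [Module (MvPolynomial σ k) M]
    [IsScalarTower k (MvPolynomial σ k) M] (N : ℤ → Submodule k M) (p : ℕ) : Prop :=
  ∀ j, ∀ c ∈ koszulChain σ N p j, koszulD k M c = 0 →
    c ∈ (koszulChain σ N (p + 1) (j - 1)).map (koszulDₖ k M)

/-- `N'' → N → M'` is exact in each degree, with a graded map `w`. -/
structure ColumnExact (w : M'' →ₗ[MvPolynomial σ k] M) (v : M →ₗ[MvPolynomial σ k] M')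
    (N'' : ℤ → Submodule k M'') (N : ℤ → Submodule k M) : Prop where
  map_mem : ∀ j, ∀ m ∈ N'' j, w m ∈ N j
  comp_eq_zero : ∀ m, v (w m) = 0
  exists_lift : ∀ j, ∀ m ∈ N j, v m = 0 → ∃ m' ∈ N'' j, w m' = m

theorem ColumnExact.mem_map_iff {w : M'' →ₗ[MvPolynomial σ k] M} {v : M →ₗ[MvPolynomial σ k] M'}
    {N'' : ℤ → Submodule k M''} {N : ℤ → Submodule k M} (h : ColumnExact w v N'' N) {p : ℕ} {j : ℤ}
    {c : Finset σ → M} (hc : c ∈ koszulChain σ N p j) :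
    c ∈ (koszulChain σ N'' p j).map (chainMap σ w) ↔ chainMap σ v c = 0 := by
  constructor
  · rintro ⟨c', -, rfl⟩
    ext1 S
    exact h.comp_eq_zero _
  · intro hv
    exact exists_chain_lift (fun S hS => h.exists_lift j _ ((hc S).1 hS) (congrFun hv S))
      fun S => (hc S).2

/-- Homology of the image of the Koszul complex of `N''` in that of `M`. -/
noncomputable def imageHomologyRank (w : M'' →ₗ[MvPolynomial σ k] M) (N'' : ℤ → Submodule k M'')
    (p : ℕ) (j : ℤ) : ℕ :=
  Module.finrank k
    (↥(LinearMap.ker (koszulDₖ k M) ⊓ (koszulChain σ N'' p j).map (chainMap σ w)) ⧸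
      (((koszulChain σ N'' (p + 1) (j - 1)).map (chainMap σ w)).map (koszulDₖ k M)).submoduleOf
        (LinearMap.ker (koszulDₖ k M) ⊓ (koszulChain σ N'' p j).map (chainMap σ w)))

/-- The cycles that bound in the Koszul complex of `N`, modulo the boundaries from the image of
the Koszul complex of `N''`. -/
noncomputable def boundingRank (w : M'' →ₗ[MvPolynomial σ k] M) (N'' : ℤ → Submodule k M'')
    (N : ℤ → Submodule k M) (p : ℕ) (j : ℤ) : ℕ :=
  Module.finrank k
    (↥((koszulChain σ N (p + 1) (j - 1)).map (koszulDₖ k M) ⊓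
        (koszulChain σ N'' p j).map (chainMap σ w)) ⧸
      (((koszulChain σ N'' (p + 1) (j - 1)).map (chainMap σ w)).map (koszulDₖ k M)).submoduleOf
        ((koszulChain σ N (p + 1) (j - 1)).map (koszulDₖ k M) ⊓
          (koszulChain σ N'' p j).map (chainMap σ w)))

theorem koszulDₖ_chainMap (φ : M →ₗ[MvPolynomial σ k] M') (c : Finset σ → M) :
    koszulDₖ k M' (chainMap σ φ c) = chainMap σ φ (koszulDₖ k M c) :=
  koszulD_map φ c

theorem koszulDₖ_koszulDₖ (c : Finset σ → M) : koszulDₖ k M (koszulDₖ k M c) = 0 :=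
  koszulD_koszulD c

theorem imageHomologyRank_eq_boundingRank {w : M'' →ₗ[MvPolynomial σ k] M}
    {N'' : ℤ → Submodule k M''} {N : ℤ → Submodule k M} (hw : ∀ j, ∀ m ∈ N'' j, w m ∈ N j)
    {p : ℕ} (hN : RowExact σ N p) (j : ℤ) :
    imageHomologyRank w N'' p j = boundingRank w N'' N p j := by
  have h : LinearMap.ker (koszulDₖ k M) ⊓ (koszulChain σ N'' p j).map (chainMap σ w) =
      (koszulChain σ N (p + 1) (j - 1)).map (koszulDₖ k M) ⊓
        (koszulChain σ N'' p j).map (chainMap σ w) := by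
    ext c
    rw [Submodule.mem_inf, Submodule.mem_inf]
    refine and_congr_left ?_
    rintro ⟨c', hc', rfl⟩
    constructor
    · intro h
      exact hN j _ (chainMap_mem hw hc') h
    · rintro ⟨b, -, hb⟩
      rw [← hb]
      exact koszulDₖ_koszulDₖ b
  unfold imageHomologyRank boundingRank
  rw [h]

/-- The connecting isomorphism, realised by the correspondence between `∂x` and `v x`. Column
exactness says that `∂x` comes from `N''` iff `v x` is a cycle; row exactness then matches the
boundaries, since either side means that `x` is a chain from `N''` plus a boundary. -/
theorem boundingRank_eq_imageHomologyRank {w : M'' →ₗ[MvPolynomial σ k] M}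
    {v : M →ₗ[MvPolynomial σ k] M'} {N'' : ℤ → Submodule k M''} {N : ℤ → Submodule k M}
    (hex : ColumnExact w v N'' N) (hgr : IsGradedFamily σ N) {p : ℕ} (hN : RowExact σ N (p + 1))
    (j : ℤ) :
    boundingRank w N'' N p j = imageHomologyRank v N (p + 1) (j - 1) := by
  refine finrank_subquotient_eq (koszulDₖ k M) (chainMap σ v) (koszulChain σ N (p + 1) (j - 1))
    inf_le_left inf_le_right ?_ ?_
  · intro x hx
    have hDx : koszulDₖ k M x ∈ koszulChain σ N p j := koszulD_mem hgr (by ring) hx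
    rw [Submodule.mem_inf, Submodule.mem_inf, hex.mem_map_iff hDx, LinearMap.mem_ker,
      koszulDₖ_chainMap]
    exact ⟨fun h => ⟨h.2, Submodule.mem_map_of_mem hx⟩,
      fun h => ⟨Submodule.mem_map_of_mem hx, h.1⟩⟩
  · intro x hx _
    constructor
    · rintro ⟨_, ⟨b, hb, rfl⟩, hbx⟩
      have hd : x - chainMap σ w b ∈ koszulChain σ N (p + 1) (j - 1) :=
        Submodule.sub_mem _ hx (chainMap_mem hex.map_mem hb)
      -- `x - w b` is a cycle, hence a boundary `∂u`, and `v` kills `w b`.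
      obtain ⟨u, hu, hux⟩ := hN _ _ hd (by
        change koszulDₖ k M _ = 0
        rw [map_sub, hbx, sub_self])
      refine ⟨_, Submodule.mem_map_of_mem hu, ?_⟩
      rw [koszulDₖ_chainMap, hux, map_sub, (hex.mem_map_iff (chainMap_mem hex.map_mem hb)).mp
        (Submodule.mem_map_of_mem hb), sub_zero]
    · rintro ⟨_, ⟨u, hu, rfl⟩, hux⟩
      have hd : x - koszulDₖ k M u ∈ koszulChain σ N (p + 1) (j - 1) :=
        Submodule.sub_mem _ hx (koszulD_mem hgr (by ring) hu)
      obtain ⟨b, hb, hbx⟩ := (hex.mem_map_iff hd).mpr (by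
        rw [map_sub, ← koszulDₖ_chainMap, hux, sub_self])
      refine ⟨_, Submodule.mem_map_of_mem hb, ?_⟩
      rw [hbx, map_sub, koszulDₖ_koszulDₖ, sub_zero]

end Chains

/-! ### Koszul chains with coefficients in a graded free module. -/

section Free

variable {σ k : Type*} [Field k]

/-- The part of degree `j` of `⨁_a B(-d a)`. -/
def freePart {r : ℕ} (d : Fin r → ℤ) (j : ℤ) : Submodule k (Fin r → MvPolynomial σ k) where
  carrier := {v | ∀ a, v a ∈ degPart σ k (j - d a)}
  zero_mem' := fun _ => Submodule.zero_mem _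
  add_mem' := fun hv hw a => Submodule.add_mem _ (hv a) (hw a)
  smul_mem' := fun c _ hv a => Submodule.smul_mem _ c (hv a)

theorem mul_mem_degPart {i j : ℤ} {f g : MvPolynomial σ k} (hf : f ∈ degPart σ k i)
    (hg : g ∈ degPart σ k j) : f * g ∈ degPart σ k (i + j) := by
  classical
  intro m hm
  rw [MvPolynomial.coeff_mul] at hm
  obtain ⟨x, hx, hne⟩ := Finset.exists_ne_zero_of_sum_ne_zero hm
  rw [← Finset.HasAntidiagonal.mem_antidiagonal.mp hx, map_add, Nat.cast_add,
    hf _ (left_ne_zero_of_mul hne), hg _ (right_ne_zero_of_mul hne)]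

theorem isGradedFamily_freePart {r : ℕ} (d : Fin r → ℤ) :
    IsGradedFamily σ (freePart (σ := σ) (k := k) d) := by
  intro j f m hf hm a
  have h := mul_mem_degPart hf (hm a)
  rwa [show 1 + (j - d a) = j + 1 - d a by ring] at h

theorem constantCoeff_eq_zero {j : ℤ} {f : MvPolynomial σ k} (hf : f ∈ degPart σ k j)
    (hj : j ≠ 0) : MvPolynomial.constantCoeff f = 0 := by
  by_contra h
  have := hf 0 h
  simp only [map_zero, Nat.cast_zero] at this
  exact hj this.symm

theorem degProj_eq_self {j : ℤ} {f : MvPolynomial σ k} (hf : f ∈ degPart σ k j) :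
    degProj j f = f := by
  ext m
  rw [coeff_degProj]
  split_ifs with h
  · rfl
  · by_contra h'
    exact h (hf m (Ne.symm h'))

theorem koszulHomotopy_mem [LinearOrder σ] {c : Finset σ → MvPolynomial σ k} {j : ℤ}
    (hc : ∀ S, c S ∈ degPart σ k j) (S : Finset σ) : koszulHomotopy c S ∈ degPart σ k (j - 1) := by
  unfold koszulHomotopy
  split_ifs
  · exact divTail_mem (hc _)
  · exact Submodule.zero_mem _

theorem koszulHomotopy_eq_zero [LinearOrder σ] {c : Finset σ → MvPolynomial σ k} {p : ℕ}
    (hc : ∀ S, S.card ≠ p → c S = 0) {S : Finset σ} (hS : S.card ≠ p + 1) :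
    koszulHomotopy c S = 0 := by
  unfold koszulHomotopy
  split_ifs with h
  · rw [hc, divTail_zero]
    rw [Finset.card_erase_of_mem (S.min'_mem h)]
    have := h.card_pos
    omega
  · rfl

/-- The map from Koszul chains to `F ⊗ k` given by the constant coefficients of the coefficient
of `e_∅`. -/
noncomputable def augmentation (σ k : Type*) [Field k] (r : ℕ) :
    (Finset σ → Fin r → MvPolynomial σ k) →ₗ[k] (Fin r → k) where
  toFun c a := MvPolynomial.constantCoeff (c ∅ a)
  map_add' _ _ := by ext1 a; simp
  map_smul' _ _ := by ext1 a; simp [MvPolynomial.smul_eq_C_mul]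

variable [LinearOrder σ] [Fintype σ]

/-- The contracting homotopy is applied in each coordinate; the constant coefficients at `e_∅` are
the only obstruction. They vanish automatically in positive Koszul degree. -/
theorem mem_map_koszulD {r : ℕ} {d : Fin r → ℤ} {p : ℕ} {j : ℤ}
    {c : Finset σ → Fin r → MvPolynomial σ k} (hc : c ∈ koszulChain σ (freePart d) p j)
    (hD : koszulD k _ c = 0) (h0 : augmentation σ k r c = 0) :
    c ∈ (koszulChain σ (freePart d) (p + 1) (j - 1)).map
      (koszulDₖ k (Fin r → MvPolynomial σ k)) := by
  refine ⟨fun S a => koszulHomotopy (fun T => c T a) S, fun S => ⟨fun _ a => ?_, fun h => ?_⟩, ?_⟩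
  · have := koszulHomotopy_mem (c := fun T => c T a) (j := j - d a)
      (fun T => koszulChain_apply_mem hc T a) S
    rwa [show j - d a - 1 = j - 1 - d a by ring] at this
  · ext1 a
    exact koszulHomotopy_eq_zero (c := fun T => c T a)
      (fun T hT => by rw [(hc T).2 hT]; rfl) h
  · ext1 S
    ext1 a
    have h := koszulD_koszulHomotopy (c := fun T => c T a)
      (koszulD_map (LinearMap.proj a) c |>.trans (by rw [hD]; rfl)) (congrFun h0 a)
    rw [← congrFun h S]
    change koszulD k _ (fun S a => koszulHomotopy (fun T => c T a) S) S a = _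
    exact (congrFun (koszulD_map (LinearMap.proj (R := MvPolynomial σ k) a)
      fun S a => koszulHomotopy (fun T => c T a) S) S).symm

theorem rowExact_freePart {r : ℕ} (d : Fin r → ℤ) (p : ℕ) :
    RowExact σ (freePart (σ := σ) (k := k) d) (p + 1) := fun j c hc hD =>
  mem_map_koszulD hc hD (by
    ext1 a
    change MvPolynomial.constantCoeff (c ∅ a) = 0
    rw [(hc ∅).2 (by simp)]
    simp)

theorem augmentation_koszulD {r : ℕ} (c : Finset σ → Fin r → MvPolynomial σ k) :
    augmentation σ k r (koszulDₖ k _ c) = 0 := by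
  ext1 a
  change MvPolynomial.constantCoeff (koszulD k _ c ∅ a) = 0
  rw [koszulD_apply, Finset.sum_apply, map_sum]
  refine Finset.sum_eq_zero fun x _ => ?_
  rw [Pi.smul_apply, smul_eq_mul, map_mul,
    constantCoeff_eq_zero (koszulCoeff_mem x ∅) one_ne_zero, zero_mul]

theorem augmentation_chainMap {r r' : ℕ} (A : Matrix (Fin r) (Fin r') (MvPolynomial σ k))
    (c : Finset σ → Fin r' → MvPolynomial σ k) :
    augmentation σ k r (chainMap σ A.mulVecLin c) =
      (A.map MvPolynomial.constantCoeff).mulVecLin (augmentation σ k r' c) := by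
  ext1 a
  change MvPolynomial.constantCoeff (∑ b, A a b * c ∅ b) =
    ∑ b, MvPolynomial.constantCoeff (A a b) * MvPolynomial.constantCoeff (c ∅ b)
  rw [map_sum]
  simp only [map_mul]

end Free

end GradedPoly

namespace GradedPoly

/-! ### Balance of Tor. -/

section Balance

variable {σ k : Type*} [Field k]

theorem mulVec_mem_freePart {r r' : ℕ} {d : Fin r → ℤ} {d' : Fin r' → ℤ}
    {A : Matrix (Fin r) (Fin r') (MvPolynomial σ k)}
    (hA : ∀ a b, A a b ∈ degPart σ k (d' b - d a)) {j : ℤ} {m : Fin r' → MvPolynomial σ k}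
    (hm : m ∈ freePart d' j) : A.mulVecLin m ∈ freePart d j := by
  intro a
  change ∑ b, A a b * m b ∈ _
  refine Submodule.sum_mem _ fun b _ => ?_
  have h := mul_mem_degPart (hA a b) (hm b)
  rwa [show d' b - d a + (j - d' b) = j - d a by ring] at h

/-- The matrix is homogeneous, so any preimage can be replaced by its component of degree `j`. -/
theorem exists_mulVec_eq {r r' : ℕ} {d : Fin r → ℤ} {d' : Fin r' → ℤ}
    {A : Matrix (Fin r) (Fin r') (MvPolynomial σ k)}
    (hA : ∀ a b, A a b ∈ degPart σ k (d' b - d a)) {j : ℤ} {m : Fin r → MvPolynomial σ k}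
    (hm : m ∈ freePart d j) (hr : m ∈ LinearMap.range A.mulVecLin) :
    ∃ m' ∈ freePart d' j, A.mulVecLin m' = m := by
  obtain ⟨v, rfl⟩ := hr
  refine ⟨fun b => degProj (j - d' b) (v b), fun b => degProj_mem _ _, ?_⟩
  ext1 a
  rw [← degProj_eq_self (hm a)]
  change ∑ b, A a b * degProj (j - d' b) (v b) = degProj (j - d a) (∑ b, A a b * v b)
  rw [degProj_sum]
  refine Finset.sum_congr rfl fun b _ => ?_
  rw [degProj_mul (hA a b)]
  congr 2
  ring

variable {I : Ideal (MvPolynomial σ k)} (F : GradedFreeResolution I)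

theorem GradedFreeResolution.columnExact_diff (n : ℕ) :
    ColumnExact (F.diff (n + 1)).mulVecLin (F.diff n).mulVecLin
      (freePart (F.deg (n + 2))) (freePart (F.deg (n + 1))) where
  map_mem _ _ hm := mulVec_mem_freePart (F.diff_mem (n + 1)) hm
  comp_eq_zero m := by
    rw [← LinearMap.mem_ker, ← F.exact_succ n]
    exact LinearMap.mem_range_self _ _
  exists_lift j m hm hv := exists_mulVec_eq (F.diff_mem (n + 1)) hm (by
    rw [F.exact_succ n]; exact hv)

/-- The surjection of `F_0` onto the ideal. -/
noncomputable abbrev GradedFreeResolution.genMap :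
    (Fin (F.rank 0) → MvPolynomial σ k) →ₗ[MvPolynomial σ k] MvPolynomial σ k :=
  Fintype.linearCombination (MvPolynomial σ k) F.gen

theorem GradedFreeResolution.columnExact_gen :
    ColumnExact (F.diff 0).mulVecLin F.genMap (freePart (F.deg 1)) (freePart (F.deg 0)) where
  map_mem _ _ hm := mulVec_mem_freePart (F.diff_mem 0) hm
  comp_eq_zero m := by
    rw [← LinearMap.mem_ker, ← F.exact_zero]
    exact LinearMap.mem_range_self _ _
  exists_lift j m hm hv := exists_mulVec_eq (F.diff_mem 0) hm (by
    rw [F.exact_zero]; exact hv)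

theorem GradedFreeResolution.genMap_mem {j : ℤ} {m : Fin (F.rank 0) → MvPolynomial σ k}
    (hm : m ∈ freePart (F.deg 0) j) :
    F.genMap m ∈ I.restrictScalars k ⊓ degPart σ k j := by
  rw [Fintype.linearCombination_apply]
  refine ⟨?_, Submodule.sum_mem _ fun a _ => ?_⟩
  · change _ ∈ I
    refine Submodule.sum_mem _ fun a _ => I.mul_mem_left _ ?_
    exact F.span_gen.le (Ideal.subset_span ⟨a, rfl⟩)
  · have h := mul_mem_degPart (hm a) (F.gen_mem a)
    rwa [sub_add_cancel] at h

theorem GradedFreeResolution.exists_genMap_eq {j : ℤ} {f : MvPolynomial σ k} (hf : f ∈ I)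
    (hj : f ∈ degPart σ k j) : ∃ m ∈ freePart (F.deg 0) j, F.genMap m = f := by
  obtain ⟨v, rfl⟩ : ∃ v, F.genMap v = f := by
    rw [← F.span_gen, Ideal.span, ← Fintype.range_linearCombination] at hf
    exact hf
  refine ⟨fun b => degProj (j - F.deg 0 b) (v b), fun b => degProj_mem _ _, ?_⟩
  rw [← degProj_eq_self hj, Fintype.linearCombination_apply, Fintype.linearCombination_apply,
    degProj_sum]
  refine Finset.sum_congr rfl fun b _ => ?_
  rw [smul_eq_mul, smul_eq_mul, mul_comm, mul_comm (v b), degProj_mul (F.gen_mem b)]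

theorem augmentation_mem_tensorDeg {n : ℕ} {j : ℤ} {c : Finset σ → Fin (F.rank n) → MvPolynomial σ k}
    (hc : c ∈ koszulChain σ (freePart (F.deg n)) 0 j) :
    augmentation σ k _ c ∈ F.tensorDeg n j := by
  intro a ha
  by_contra h
  exact ha (constantCoeff_eq_zero (koszulChain_apply_mem hc ∅ a) (by omega))

theorem tensorDeg_le_map_augmentation (n : ℕ) (j : ℤ) :
    F.tensorDeg n j ≤ (koszulChain σ (freePart (F.deg n)) 0 j).map
      (augmentation σ k (F.rank n)) := by
  classical
  intro t ht
  refine ⟨fun S => if S = ∅ then fun a => MvPolynomial.C (t a) else 0, fun S => ⟨?_, ?_⟩, ?_⟩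
  · intro hS a
    rw [Finset.card_eq_zero] at hS
    simp only [if_pos hS]
    intro m hm
    rw [MvPolynomial.coeff_C] at hm
    split_ifs at hm with h
    · rw [ht a hm, ← h]; simp
    · exact absurd rfl hm
  · intro hS
    rw [Ne, Finset.card_eq_zero] at hS
    simp only [if_neg hS]
  · ext1 a
    simp [augmentation]

variable [LinearOrder σ] [Fintype σ]

/-- Both sides say that `x` is the sum of a Koszul boundary from `K_1 ⊗ F_n` and an image from `K_0
⊗ F_{n+1}`: the augmentation kills exactly the former, `v` exactly the latter. -/
theorem augmentation_mem_boundaries_iff {M' : Type*} [AddCommGroup M'] [Module k M']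
    [Module (MvPolynomial σ k) M'] [IsScalarTower k (MvPolynomial σ k) M'] {n : ℕ}
    {v : (Fin (F.rank n) → MvPolynomial σ k) →ₗ[MvPolynomial σ k] M'}
    (hex : ColumnExact (F.diff n).mulVecLin v (freePart (F.deg (n + 1))) (freePart (F.deg n)))
    {j : ℤ} {x : Finset σ → Fin (F.rank n) → MvPolynomial σ k}
    (hx : x ∈ koszulChain σ (freePart (F.deg n)) 0 j) :
    augmentation σ k _ x ∈ F.boundaries n ⊓ F.tensorDeg n j ↔
      chainMap σ v x ∈ ((koszulChain σ (freePart (F.deg n)) 1 (j - 1)).map (chainMap σ v)).map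
        (koszulDₖ k M') := by
  constructor
  · rintro ⟨⟨t, ht⟩, htx⟩
    -- A preimage of degree `j` is needed for lifting to chains. Truncation is harmless because an
    -- entry of `diffBar` vanishes unless the degrees of its row and column agree.
    let t' : Fin (F.rank (n + 1)) → k := fun b => if F.deg (n + 1) b = j then t b else 0
    have ht' : t' ∈ F.tensorDeg (n + 1) j := by
      intro b hb
      by_contra h
      exact hb (if_neg h)
    have htt : (F.diffBar n).mulVecLin t' = augmentation σ k _ x := by
      ext1 a
      rw [← ht]
      change ∑ b, F.diffBar n a b * t' b = ∑ b, F.diffBar n a b * t b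
      by_cases ha : F.deg n a = j
      · refine Finset.sum_congr rfl fun b _ => ?_
        by_cases hb : F.deg (n + 1) b = j
        · simp only [t', if_pos hb]
        · have h0 : F.diffBar n a b = 0 :=
            constantCoeff_eq_zero (F.diff_mem n a b) (by omega)
          rw [h0, zero_mul, zero_mul]
      · have h1 : ∑ b, F.diffBar n a b * t b = 0 := by
          by_contra h
          refine ha (htx a ?_)
          rw [← ht]
          exact h
        rw [h1]
        refine Finset.sum_eq_zero fun b _ => ?_
        by_cases hb : F.deg (n + 1) b = j
        · have h0 : F.diffBar n a b = 0 :=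
            constantCoeff_eq_zero (F.diff_mem n a b) (by omega)
          rw [h0, zero_mul]
        · simp only [t', if_neg hb, mul_zero]
    obtain ⟨c, hc, hct⟩ := tensorDeg_le_map_augmentation F (n + 1) j ht'
    have hd : x - chainMap σ (F.diff n).mulVecLin c ∈ koszulChain σ (freePart (F.deg n)) 0 j :=
      Submodule.sub_mem _ hx (chainMap_mem hex.map_mem hc)
    obtain ⟨u, hu, hux⟩ := mem_map_koszulD hd (koszulD_eq_zero hd) (by
      rw [map_sub, augmentation_chainMap, hct, ← htt]
      exact sub_self _)
    refine ⟨_, Submodule.mem_map_of_mem hu, ?_⟩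
    rw [koszulDₖ_chainMap, hux, map_sub, (hex.mem_map_iff (chainMap_mem hex.map_mem hc)).mp
      (Submodule.mem_map_of_mem hc), sub_zero]
  · rintro ⟨_, ⟨u, hu, rfl⟩, hux⟩
    refine ⟨?_, augmentation_mem_tensorDeg F hx⟩
    have hd : x - koszulDₖ k _ u ∈ koszulChain σ (freePart (F.deg n)) 0 j :=
      Submodule.sub_mem _ hx (koszulD_mem (isGradedFamily_freePart _) (by ring) hu)
    obtain ⟨c, hc, hcx⟩ := (hex.mem_map_iff hd).mpr (by
      rw [map_sub, ← koszulDₖ_chainMap, hux, sub_self])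
    refine ⟨augmentation σ k _ c, ?_⟩
    have h := augmentation_chainMap (F.diff n) c
    rw [hcx, map_sub, augmentation_koszulD, sub_zero] at h
    exact h.symm

theorem finrank_torPart_zero (j : ℤ) :
    Module.finrank k (F.TorPart 0 j) = imageHomologyRank F.genMap (freePart (F.deg 0)) 0 j := by
  refine finrank_subquotient_eq (augmentation σ k _) (chainMap σ F.genMap)
    (koszulChain σ (freePart (F.deg 0)) 0 j)
    (inf_le_right.trans (tensorDeg_le_map_augmentation F 0 j)) inf_le_right ?_ ?_
  · intro x hx
    refine iff_of_true ⟨trivial, augmentation_mem_tensorDeg F hx⟩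
      ⟨?_, Submodule.mem_map_of_mem hx⟩
    have h : koszulDₖ k _ x = 0 := koszulD_eq_zero hx
    change koszulDₖ k _ (chainMap σ F.genMap x) = 0
    rw [koszulDₖ_chainMap, h, map_zero]
  · intro x hx _
    exact augmentation_mem_boundaries_iff F F.columnExact_gen hx

/-- An element of `F_{n+1} ⊗ k` lifts to `K_0 ⊗ F_{n+1}` and is pushed to `K_0 ⊗ F_n`. It is a cycle
iff the result has zero augmentation, that is, iff it bounds in `K ⊗ F_n`. -/
theorem finrank_torPart_succ (n : ℕ) (j : ℤ) :
    Module.finrank k (F.TorPart (n + 1) j) =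
      boundingRank (F.diff n).mulVecLin (freePart (F.deg (n + 1))) (freePart (F.deg n)) 0 j := by
  have hmem := fun j m hm => mulVec_mem_freePart (F.diff_mem n) (j := j) (m := m) hm
  refine finrank_subquotient_eq (augmentation σ k _) (chainMap σ (F.diff n).mulVecLin)
    (koszulChain σ (freePart (F.deg (n + 1))) 0 j)
    (inf_le_right.trans (tensorDeg_le_map_augmentation F (n + 1) j)) inf_le_right ?_ ?_
  · intro x hx
    have hv := chainMap_mem hmem hx
    constructor
    · rintro ⟨h, -⟩
      refine ⟨mem_map_koszulD hv (koszulD_eq_zero hv) ?_, Submodule.mem_map_of_mem hx⟩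
      rw [augmentation_chainMap]
      exact h
    · rintro ⟨⟨u, hu, hux⟩, -⟩
      refine ⟨?_, augmentation_mem_tensorDeg F hx⟩
      change (F.diffBar n).mulVecLin _ = 0
      have h := augmentation_chainMap (F.diff n) x
      rw [← hux, augmentation_koszulD] at h
      exact h.symm
  · intro x hx _
    exact augmentation_mem_boundaries_iff F (F.columnExact_diff n) hx

/-- Each step down the resolution trades one homological degree of `F` for one Koszul degree, until
the image of `F_0`, the ideal itself, is reached. -/
theorem boundingRank_diff (n : ℕ) : ∀ (p : ℕ) (j : ℤ),
    boundingRank (F.diff n).mulVecLin (freePart (F.deg (n + 1))) (freePart (F.deg n)) p j =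
      imageHomologyRank F.genMap (freePart (F.deg 0)) (p + n + 1) (j - n - 1) := by
  induction n with
  | zero =>
    intro p j
    rw [boundingRank_eq_imageHomologyRank F.columnExact_gen (isGradedFamily_freePart _)
      (rowExact_freePart _ p)]
    simp
  | succ n ih =>
    intro p j
    rw [boundingRank_eq_imageHomologyRank (F.columnExact_diff n) (isGradedFamily_freePart _)
      (rowExact_freePart _ p), imageHomologyRank_eq_boundingRank
      (fun j m hm => mulVec_mem_freePart (F.diff_mem n) hm) (rowExact_freePart _ p), ih]
    congr 1
    · ring
    · push_cast; ring

/-- Balance of Tor: it can be computed with the Koszul complex. -/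
theorem finrank_torPart (i : ℕ) (j : ℤ) :
    Module.finrank k (F.TorPart i (i + j)) =
      imageHomologyRank F.genMap (freePart (F.deg 0)) i j := by
  cases i with
  | zero => rw [finrank_torPart_zero]; simp
  | succ n =>
    rw [finrank_torPart_succ, boundingRank_diff]
    congr 1
    · ring
    · push_cast; ring

end Balance

/-! ### Betti numbers as Koszul homology of the ideal. -/

section Ideals

variable {σ k : Type*} [Field k] [LinearOrder σ] [Fintype σ]

theorem map_genMap (I : HomogeneousIdeal (MvPolynomial.homogeneousSubmodule σ k))
    (F : GradedFreeResolution I.toIdeal) (p : ℕ) (j : ℤ) :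
    (koszulChain σ (freePart (F.deg 0)) p j).map (chainMap σ F.genMap) =
      koszulChain σ (component I) p j := by
  refine le_antisymm ?_ fun c hc => ?_
  · rintro _ ⟨c, hc, rfl⟩
    exact chainMap_mem (fun j m hm => F.genMap_mem hm) hc
  · exact exists_chain_lift (fun S hS => F.exists_genMap_eq ((hc S).1 hS).1 ((hc S).1 hS).2)
      fun S => (hc S).2

/-- The cycles of the Koszul complex with coefficients in the subspace `N_j` of `B`. -/
noncomputable def koszulCycles (N : ℤ → Submodule k (MvPolynomial σ k)) (i : ℕ) (j : ℤ) :
    Submodule k (Finset σ → MvPolynomial σ k) :=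
  LinearMap.ker (koszulDₖ k (MvPolynomial σ k)) ⊓ koszulChain σ N i j

/-- The image of `K ⊗ F_0` under the augmentation is `K ⊗ I`. The chosen resolution thus disappears,
and only `I_j` and `I_{j-1}` enter. -/
theorem gradedBetti_eq_koszul (I : HomogeneousIdeal (MvPolynomial.homogeneousSubmodule σ k))
    (i : ℕ) (j : ℤ) :
    gradedBetti I i (i + j) = Module.finrank k
      (↥(koszulCycles (component I) i j) ⧸
        ((koszulChain σ (component I) (i + 1) (j - 1)).map
          (koszulDₖ k (MvPolynomial σ k))).submoduleOf (koszulCycles (component I) i j)) := by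
  unfold gradedBetti
  rw [finrank_torPart]
  unfold imageHomologyRank koszulCycles
  rw [map_genMap, map_genMap]

end Ideals

end GradedPoly

namespace GradedPoly

/-! ### Rank count in the Koszul strands. -/

section Dimension

variable {σ k : Type*} [Field k]

instance finiteDimensional_degPart [Finite σ] (j : ℤ) : FiniteDimensional k (degPart σ k j) := by
  rcases lt_or_ge j 0 with hj | hj
  · rw [degPart_of_neg hj]; infer_instance
  · lift j to ℕ using hj
    rw [degPart_natCast]
    exact Module.Finite.iff_fg.mpr
      (MvPolynomial.weightedHomogeneousSubmodule_fg k (1 : σ → ℕ) (fun _ => one_ne_zero) j)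

instance finiteDimensional_component [Finite σ]
    (I : HomogeneousIdeal (MvPolynomial.homogeneousSubmodule σ k)) (j : ℤ) :
    FiniteDimensional k (component I j) :=
  Submodule.finiteDimensional_of_le (inf_le_right : component I j ≤ degPart σ k j)

theorem component_of_neg (I : HomogeneousIdeal (MvPolynomial.homogeneousSubmodule σ k)) {j : ℤ}
    (hj : j < 0) : component I j = ⊥ := by
  rw [component, degPart_of_neg hj, inf_bot_eq]

theorem isGradedFamily_component (I : HomogeneousIdeal (MvPolynomial.homogeneousSubmodule σ k)) :
    IsGradedFamily σ (component I) := by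
  intro j f m hf hm
  refine ⟨I.toIdeal.mul_mem_left f hm.1, ?_⟩
  have h := mul_mem_degPart hf hm.2
  rwa [add_comm] at h

/-- Koszul chains of degree `p` are families indexed by the subsets of cardinality `p`. -/
noncomputable def koszulChainEquiv {M : Type*} [AddCommGroup M] [Module k M]
    (N : ℤ → Submodule k M) (p : ℕ) (j : ℤ) :
    koszulChain σ N p j ≃ₗ[k] ({S : Finset σ // S.card = p} → N j) where
  toFun c S := ⟨c.1 S, (c.2 S).1 S.2⟩
  map_add' _ _ := rfl
  map_smul' _ _ := rfl
  invFun f := ⟨fun S => if h : S.card = p then f ⟨S, h⟩ else 0, fun S =>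
    ⟨fun h => by dsimp only; rw [dif_pos h]; exact (f ⟨S, h⟩).2,
      fun h => by dsimp only; rw [dif_neg h]⟩⟩
  left_inv c := by
    ext1
    ext1 S
    dsimp only
    split_ifs with h
    · rfl
    · exact ((c.2 S).2 h).symm
  right_inv f := by
    ext1 S
    ext1
    dsimp only
    rw [dif_pos S.2]

theorem koszulChain_congr {M : Type*} [AddCommGroup M] [Module k M] {N N' : ℤ → Submodule k M}
    {j : ℤ} (h : N j = N' j) (p : ℕ) : koszulChain σ N p j = koszulChain σ N' p j := by
  ext c
  change (∀ S, (S.card = p → c S ∈ N j) ∧ _) ↔ ∀ S, (S.card = p → c S ∈ N' j) ∧ _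
  rw [h]

variable [Fintype σ]

theorem finrank_koszulChain {M : Type*} [AddCommGroup M] [Module k M] (N : ℤ → Submodule k M)
    (p : ℕ) (j : ℤ) [FiniteDimensional k (N j)] :
    Module.finrank k (koszulChain σ N p j) =
      (Fintype.card σ).choose p * Module.finrank k (N j) := by
  rw [(koszulChainEquiv N p j).finrank_eq, Module.finrank_pi_fintype, Finset.sum_const,
    Finset.card_univ, Fintype.card_finset_len, smul_eq_mul]

theorem finiteDimensional_koszulChain {M : Type*} [AddCommGroup M] [Module k M]
    (N : ℤ → Submodule k M) (p : ℕ) (j : ℤ) [FiniteDimensional k (N j)] :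
    FiniteDimensional k (koszulChain σ N p j) :=
  (koszulChainEquiv N p j).symm.finiteDimensional

variable [LinearOrder σ]

theorem finrank_map_koszulD (N : ℤ → Submodule k (MvPolynomial σ k)) (p : ℕ) (j : ℤ)
    [FiniteDimensional k (N j)] :
    Module.finrank k ((koszulChain σ N p j).map (koszulDₖ k (MvPolynomial σ k))) +
        Module.finrank k (koszulCycles N p j) =
      (Fintype.card σ).choose p * Module.finrank k (N j) := by
  have := finiteDimensional_koszulChain (σ := σ) N p j
  have h := ((koszulDₖ k (MvPolynomial σ k)).domRestrict
    (koszulChain σ N p j)).finrank_range_add_finrank_ker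
  rw [LinearMap.range_domRestrict, LinearMap.ker_domRestrict, finrank_koszulChain] at h
  rw [← h]
  congr 1
  refine (LinearEquiv.finrank_eq (Submodule.submoduleOfEquivOfLe
    (inf_le_right : koszulCycles N p j ≤ _))).symm.trans ?_
  unfold Submodule.submoduleOf
  rw [Submodule.comap_inf, Submodule.comap_subtype_self, inf_top_eq]

/-- The rank of the space of cycles of the Koszul complex with coefficients in `I_j`. -/
noncomputable def cycleRank (I : HomogeneousIdeal (MvPolynomial.homogeneousSubmodule σ k))
    (i : ℕ) (j : ℤ) : ℕ :=
  Module.finrank k (koszulCycles (component I) i j)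

/-- The pivot of the argument: `I` may be exchanged for any ideal with the same forms of degree `j`,
in particular for `I_⟨j⟩`. -/
theorem cycleRank_congr {I I' : HomogeneousIdeal (MvPolynomial.homogeneousSubmodule σ k)} {j : ℤ}
    (h : component I j = component I' j) (i : ℕ) : cycleRank I i j = cycleRank I' i j := by
  unfold cycleRank koszulCycles
  rw [koszulChain_congr h]

theorem cycleRank_zero (I : HomogeneousIdeal (MvPolynomial.homogeneousSubmodule σ k)) (j : ℤ) :
    cycleRank I 0 j = componentRank I j := by
  have h : koszulCycles (component I) 0 j = koszulChain σ (component I) 0 j :=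
    inf_eq_right.mpr fun c hc => koszulD_eq_zero hc
  rw [cycleRank, h, finrank_koszulChain, Nat.choose_zero_right, one_mul, componentRank]

theorem cycleRank_eq_zero {I : HomogeneousIdeal (MvPolynomial.homogeneousSubmodule σ k)} {j : ℤ}
    (h : component I j = ⊥) (i : ℕ) : cycleRank I i j = 0 := by
  have h1 := finrank_map_koszulD (component I) i j
  rw [h, finrank_bot, mul_zero] at h1
  exact (Nat.add_eq_zero_iff.mp h1).2

theorem componentRank_eq_zero {I : HomogeneousIdeal (MvPolynomial.homogeneousSubmodule σ k)}
    {j : ℤ} (h : component I j = ⊥) : componentRank I j = 0 := by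
  rw [componentRank, h, finrank_bot]

/-- Homology is cycles modulo boundaries, and rank-nullity on `K_{i+1} ⊗ I_{j-1}` expresses the
boundaries by cycles. The additive form avoids truncated subtraction. -/
theorem gradedBetti_add (I : HomogeneousIdeal (MvPolynomial.homogeneousSubmodule σ k))
    (i : ℕ) (j : ℤ) :
    gradedBetti I i (i + j) + (Fintype.card σ).choose (i + 1) * componentRank I (j - 1) =
      cycleRank I i j + cycleRank I (i + 1) (j - 1) := by
  have := finiteDimensional_koszulChain (σ := σ) (component I) i j
  have : FiniteDimensional k (koszulCycles (component I) i j) :=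
    Submodule.finiteDimensional_of_le (inf_le_right : _ ≤ koszulChain σ (component I) i j)
  have hle : (koszulChain σ (component I) (i + 1) (j - 1)).map (koszulDₖ k (MvPolynomial σ k)) ≤
      koszulCycles (component I) i j := by
    rintro _ ⟨c, hc, rfl⟩
    exact ⟨koszulDₖ_koszulDₖ c, koszulD_mem (isGradedFamily_component I) (by ring) hc⟩
  rw [gradedBetti_eq_koszul, cycleRank, cycleRank, componentRank,
    ← Submodule.finrank_quotient_add_finrank
      (((koszulChain σ (component I) (i + 1) (j - 1)).map
          (koszulDₖ k (MvPolynomial σ k))).submoduleOf (koszulCycles (component I) i j)),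
    (Submodule.submoduleOfEquivOfLe hle).finrank_eq, add_assoc, finrank_map_koszulD]

/-- The boundaries in `K_0 ⊗ I_j` lie in `B_1 I_{j-1}`, so `β_{0,j} = 0` forces `I_j = B_1 I_{j-1}`.
Finiteness of `𝕁` follows. -/
theorem generatorDegrees_subset (I : HomogeneousIdeal (MvPolynomial.homogeneousSubmodule σ k)) :
    generatorDegrees I ⊆ Function.support fun j => gradedBetti I 0 j := by
  intro j hj h0
  refine hj (le_antisymm (fun f hf => ?_) (Submodule.mul_le.mpr fun p hp f hf => ?_))
  · have h1 := gradedBetti_eq_koszul I 0 j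
    rw [Nat.cast_zero, zero_add] at h1
    have := finiteDimensional_koszulChain (σ := σ) (component I) 0 j
    have : FiniteDimensional k (koszulCycles (component I) 0 j) :=
      Submodule.finiteDimensional_of_le (inf_le_right : _ ≤ koszulChain σ (component I) 0 j)
    have h2 := Module.finrank_zero_iff.mp (h1.symm.trans h0)
    rw [Submodule.Quotient.subsingleton_iff, Submodule.submoduleOf_eq_top] at h2
    have hc : (fun S : Finset σ => if S.card = 0 then f else 0) ∈
        koszulChain σ (component I) 0 j := fun S =>
      ⟨fun h => by dsimp only; rwa [if_pos h], fun h => if_neg h⟩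
    obtain ⟨c, hc, hcf⟩ := h2 ⟨koszulD_eq_zero hc, hc⟩
    have h3 : koszulD k _ c ∅ = f := (congrFun hcf ∅).trans (if_pos rfl)
    rw [← h3, koszulD_apply]
    exact Submodule.sum_mem _ fun x _ =>
      Submodule.mul_mem_mul (koszulCoeff_mem x ∅) (koszulChain_apply_mem hc _)
  · have h := isGradedFamily_component I hp hf
    rwa [sub_add_cancel] at h

end Dimension

/-! ### The ideals generated by single components. -/

section ComponentIdeal

variable {σ k : Type*} [Field k]

theorem component_componentIdeal_self
    (I : HomogeneousIdeal (MvPolynomial.homogeneousSubmodule σ k)) (j : ℤ) :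
    component (componentIdeal I j) j = component I j := by
  refine le_antisymm (fun f hf => ⟨?_, hf.2⟩) fun f hf => ⟨Ideal.subset_span hf, hf.2⟩
  have h : (componentIdeal I j).toIdeal ≤ I.toIdeal := Ideal.span_le.mpr fun g hg => hg.1
  exact h hf.1

theorem component_componentIdeal_of_lt
    (I : HomogeneousIdeal (MvPolynomial.homogeneousSubmodule σ k)) {j h : ℤ} (hh : h < j) :
    component (componentIdeal I j) h = ⊥ := by
  classical
  have key : ∀ f ∈ (componentIdeal I j).toIdeal, ∀ m, MvPolynomial.coeff m f ≠ 0 →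
      j ≤ (m.degree : ℤ) := by
    intro f hf
    refine Submodule.span_induction (p := fun f _ => ∀ m, MvPolynomial.coeff m f ≠ 0 →
      j ≤ (m.degree : ℤ)) ?_ ?_ ?_ ?_ hf
    · intro g hg m hm
      exact (hg.2 m hm).ge
    · intro m hm
      exact absurd (MvPolynomial.coeff_zero m) hm
    · intro g g' _ _ hg hg' m hm
      by_cases h0 : MvPolynomial.coeff m g = 0
      · refine hg' m fun h1 => hm ?_
        rw [MvPolynomial.coeff_add, h0, h1, add_zero]
      · exact hg m h0
    · intro a g _ hg m hm
      rw [smul_eq_mul, MvPolynomial.coeff_mul] at hm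
      obtain ⟨x, hx, hne⟩ := Finset.exists_ne_zero_of_sum_ne_zero hm
      have h1 := hg x.2 (right_ne_zero_of_mul hne)
      rw [← Finset.HasAntidiagonal.mem_antidiagonal.mp hx, map_add, Nat.cast_add]
      omega
  rw [eq_bot_iff]
  intro f hf
  rw [Submodule.mem_bot]
  ext m
  by_contra hm
  have h1 := key f hf.1 m hm
  have h2 := hf.2 m hm
  omega

theorem component_componentIdeal_of_notMem
    (I : HomogeneousIdeal (MvPolynomial.homogeneousSubmodule σ k)) {j : ℤ}
    (hj : j ∉ generatorDegrees I) : component (componentIdeal I (j - 1)) j = component I j := by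
  refine le_antisymm ?_ ?_
  · refine fun f hf => ⟨?_, hf.2⟩
    have h : (componentIdeal I (j - 1)).toIdeal ≤ I.toIdeal := Ideal.span_le.mpr fun g hg => hg.1
    exact h hf.1
  · have hI : component I j = degPart σ k 1 * component I (j - 1) := not_not.mp hj
    rw [hI, Submodule.mul_le]
    intro p hp f hf
    have h := isGradedFamily_component (componentIdeal I (j - 1)) hp
      (m := f) ((component_componentIdeal_self I (j - 1)).ge hf)
    rwa [sub_add_cancel] at h

variable [Fintype σ]

/-- In `gradedBetti_add`, `I` and `I_⟨j-1⟩` have the same terms besides the Betti number, and `i +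
j` is off the linear strand of `I_⟨j-1⟩`. -/
theorem gradedBetti_eq_zero_of_notMem [LinearOrder σ]
    {I : HomogeneousIdeal (MvPolynomial.homogeneousSubmodule σ k)}
    (hI : IsComponentwiseLinear I) {j : ℤ} (hj : j ∉ generatorDegrees I) (i : ℕ) :
    gradedBetti I i (i + j) = 0 := by
  have h1 := gradedBetti_add I i j
  have h2 := gradedBetti_add (componentIdeal I (j - 1)) i j
  rw [hI (j - 1) i (i + j) (by omega), componentRank, component_componentIdeal_self,
    cycleRank_congr (component_componentIdeal_of_notMem I hj),
    cycleRank_congr (component_componentIdeal_self I (j - 1))] at h2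
  rw [componentRank] at h1
  omega

end ComponentIdeal

/-! ### Hilbert series and Betti numbers. -/

section Series

variable {σ k : Type*} [Field k] [Fintype σ]

theorem coeff_one_sub_X_pow (e p : ℕ) :
    PowerSeries.coeff p ((1 - PowerSeries.X : ℤ⟦X⟧) ^ e) = (-1) ^ p * (e.choose p : ℤ) := by
  have h : ((1 - PowerSeries.X : ℤ⟦X⟧) ^ e) = PowerSeries.rescale (-1 : ℤ)
      (((1 + Polynomial.X : Polynomial ℤ) ^ e : Polynomial ℤ) : ℤ⟦X⟧) := by
    simp [PowerSeries.rescale_X, sub_eq_add_neg]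
  rw [h, PowerSeries.coeff_rescale, Polynomial.coeff_coe, Polynomial.coeff_one_add_X_pow]

/-- The Hilbert series of the ideal `I`. -/
noncomputable def idealSeries (I : HomogeneousIdeal (MvPolynomial.homogeneousSubmodule σ k)) :
    ℤ⟦X⟧ :=
  PowerSeries.mk fun n : ℕ => (componentRank I n : ℤ)

theorem hilbertSeries_add_idealSeries
    (I : HomogeneousIdeal (MvPolynomial.homogeneousSubmodule σ k)) :
    hilbertSeries I + idealSeries I =
      PowerSeries.mk fun n : ℕ => (Module.finrank k (degPart σ k n) : ℤ) := by
  ext n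
  rw [map_add, hilbertSeries, idealSeries, PowerSeries.coeff_mk, PowerSeries.coeff_mk,
    PowerSeries.coeff_mk]
  have h := ((Ideal.Quotient.mkₐ k I.toIdeal).toLinearMap.domRestrict
    (degPart σ k n)).finrank_range_add_finrank_ker
  rw [LinearMap.range_domRestrict, LinearMap.ker_domRestrict] at h
  rw [← h, Nat.cast_add]
  congr 2
  refine (LinearEquiv.finrank_eq (Submodule.submoduleOfEquivOfLe
    (inf_le_right : component I n ≤ _))).symm.trans ?_
  unfold Submodule.submoduleOf
  rw [Submodule.comap_inf, Submodule.comap_subtype_self, inf_top_eq]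
  have hker : LinearMap.ker (Ideal.Quotient.mkₐ k I.toIdeal).toLinearMap =
      I.toIdeal.restrictScalars k := by
    ext f
    simp [Ideal.Quotient.eq_zero_iff_mem]
  rw [hker]

variable [LinearOrder σ]

/-- `gradedBetti_add` telescopes along the strand of fixed internal degree `n`, leaving one cycle
rank as remainder. -/
theorem sum_range_choose_mul_componentRank
    (I : HomogeneousIdeal (MvPolynomial.homogeneousSubmodule σ k)) (n : ℤ) (N : ℕ) :
    ∑ p ∈ Finset.range (N + 1),
        (-1) ^ p * ((Fintype.card σ).choose p : ℤ) * (componentRank I (n - p) : ℤ) =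
      (-1) ^ N * (cycleRank I N (n - N) : ℤ) +
        ∑ i ∈ Finset.range N, (-1) ^ i * (gradedBetti I i n : ℤ) := by
  induction N with
  | zero => simp [cycleRank_zero]
  | succ N ih =>
    have h := gradedBetti_add I N (n - N)
    rw [add_sub_cancel, sub_sub] at h
    zify at h
    rw [Finset.sum_range_succ, ih, Finset.sum_range_succ]
    push_cast
    have h' := congrArg (fun t => (-1 : ℤ) ^ N * t) h
    simp only [mul_add] at h'
    rw [pow_succ]
    linear_combination -h'

/-- The Euler characteristic of the Koszul strand of degree `n`. At `N = n` the telescoping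
remainder is itself `β_{n,n}`, because `I_{-1} = 0`. -/
theorem coeff_one_sub_X_pow_mul_idealSeries
    (I : HomogeneousIdeal (MvPolynomial.homogeneousSubmodule σ k)) (n : ℕ) :
    PowerSeries.coeff n ((1 - PowerSeries.X) ^ Fintype.card σ * idealSeries I) =
      ∑ i ∈ Finset.range (n + 1), (-1) ^ i * (gradedBetti I i n : ℤ) := by
  have h1 := sum_range_choose_mul_componentRank I n n
  have h2 := gradedBetti_add I n 0
  rw [cycleRank_eq_zero (component_of_neg I (j := 0 - 1) (by norm_num)),
    componentRank_eq_zero (component_of_neg I (j := 0 - 1) (by norm_num)), mul_zero, add_zero,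
    add_zero, add_zero] at h2
  rw [sub_self, ← h2, add_comm ((-1) ^ n * (gradedBetti I n n : ℤ)), ← Finset.sum_range_succ (fun i => (-1) ^ i *
    (gradedBetti I i n : ℤ))] at h1
  rw [← h1, PowerSeries.coeff_mul, Finset.Nat.sum_antidiagonal_eq_sum_range_succ_mk]
  refine Finset.sum_congr rfl fun p hp => ?_
  rw [coeff_one_sub_X_pow, idealSeries, PowerSeries.coeff_mk,
    Nat.cast_sub (Nat.lt_succ_iff.mp (Finset.mem_range.mp hp))]

variable {I : HomogeneousIdeal (MvPolynomial.homogeneousSubmodule σ k)}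

theorem coeff_idealSeries_of_lt (hI : IsComponentwiseLinear I) {j : ℤ} {n : ℕ} (hn : n < j) :
    PowerSeries.coeff n
      ((1 - PowerSeries.X) ^ Fintype.card σ * idealSeries (componentIdeal I j)) = 0 := by
  rw [coeff_one_sub_X_pow_mul_idealSeries]
  refine Finset.sum_eq_zero fun i _ => ?_
  rw [hI j i n (by omega), Nat.cast_zero, mul_zero]

/-- Linearity leaves one Betti number in the alternating sum, namely `β_{i,i+j}(I_⟨j⟩)`. It equals
the cycle rank because `I_⟨j⟩` has no forms of degree `j - 1`. -/
theorem coeff_idealSeries_of_eq (hI : IsComponentwiseLinear I) {j : ℤ} {n i : ℕ}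
    (hn : (n : ℤ) = i + j) :
    PowerSeries.coeff n
      ((1 - PowerSeries.X) ^ Fintype.card σ * idealSeries (componentIdeal I j)) =
        (-1) ^ i * (cycleRank I i j : ℤ) := by
  rw [coeff_one_sub_X_pow_mul_idealSeries]
  have h := gradedBetti_add (componentIdeal I j) i j
  rw [componentRank_eq_zero (component_componentIdeal_of_lt I (by omega)),
    cycleRank_eq_zero (I := componentIdeal I j) (j := j - 1)
      (component_componentIdeal_of_lt I (by omega)), mul_zero,
    add_zero, add_zero, cycleRank_congr (component_componentIdeal_self I j)] at h
  rw [← h, ← hn]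
  refine Finset.sum_eq_single i (fun p _ hp => ?_) fun hi => ?_
  · rw [hI j p n (by omega), Nat.cast_zero, mul_zero]
  -- Here `i > n`, so `j` is negative and the cycle rank vanishes.
  · rw [Finset.mem_range] at hi
    rw [hn, h, cycleRank_eq_zero (component_of_neg I (by omega)), Nat.cast_zero, mul_zero]

/-- The signed form of `gradedBetti_add`: the coefficient of `X^(i+j)` combines `z_{i,j}` from
`I_⟨j⟩`, `z_{i+1,j-1}` from `I_⟨j-1⟩` and the binomial term. -/
theorem one_sub_X_pow_mul_eq (hI : IsComponentwiseLinear I) (j : ℕ) :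
    (1 - PowerSeries.X) ^ Fintype.card σ *
        (idealSeries (componentIdeal I j) - idealSeries (componentIdeal I (j - 1 : ℤ)) +
          PowerSeries.X ^ (j - 1) * (componentRank I (j - 1 : ℤ) : ℤ⟦X⟧)) =
      PowerSeries.X ^ j *
        PowerSeries.mk fun i : ℕ => (-1 : ℤ) ^ i * (gradedBetti I i (i + j : ℤ) : ℤ) := by
  have hC : (componentRank I (j - 1 : ℤ) : ℤ⟦X⟧) =
      PowerSeries.C (componentRank I (j - 1 : ℤ) : ℤ) := by simp
  ext n
  rw [mul_add, mul_sub, map_add, map_sub, mul_left_comm, PowerSeries.coeff_X_pow_mul',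
    PowerSeries.coeff_X_pow_mul', hC, PowerSeries.coeff_mul_C, coeff_one_sub_X_pow,
    PowerSeries.coeff_mk]
  rcases lt_or_ge n j with hn | hn
  · rw [if_neg (not_le.mpr hn), coeff_idealSeries_of_lt hI (by omega)]
    -- The exceptional coefficient `n = j - 1` vanishes because `z_{0,j-1} = n_{j-1}`: the last
    -- summand removes the lowest term of the series of `I_⟨j-1⟩`.
    rcases lt_or_ge n (j - 1) with hn' | hn'
    · rw [if_neg (not_le.mpr hn'), coeff_idealSeries_of_lt hI (by omega)]
      simp
    · rw [if_pos hn', coeff_idealSeries_of_eq hI (i := 0) (by omega), cycleRank_zero,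
        show n - (j - 1) = 0 by omega]
      simp
  · obtain ⟨i, rfl⟩ := Nat.exists_eq_add_of_le hn
    rw [if_pos hn, if_pos (by omega), coeff_idealSeries_of_eq hI (i := i) (by push_cast; ring),
      coeff_idealSeries_of_eq hI (i := i + 1) (by push_cast; ring), Nat.add_sub_cancel_left]
    have h := gradedBetti_add I i j
    zify at h
    -- For `j = 0` the natural exponent `j - 1` is truncated to `0`, which is harmless since `n_{-1}
    -- = 0`.
    rcases Nat.eq_zero_or_pos j with rfl | hj
    · rw [componentRank_eq_zero (component_of_neg I (by norm_num))] at h ⊢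
      rw [pow_succ]
      linear_combination -(-1 : ℤ) ^ i * h
    · rw [show j + i - (j - 1) = i + 1 by omega, pow_succ]
      linear_combination -(-1 : ℤ) ^ i * h

end Series

end GradedPoly

namespace GradedPoly

/-! ### Substitution of `-yz`. -/

section Substitution

/-- Substitution of `-yz` in power series with integer coefficients, as a ring homomorphism. -/
noncomputable def substNegYZHom : ℤ⟦X⟧ →+* ZY⸨X⸩ :=
  (HahnSeries.ofPowerSeries ℤ ZY).comp
    ((PowerSeries.rescale (-(y : ZY))).comp (PowerSeries.map (Int.castRingHom ZY)))

theorem substNegYZHom_apply (H : ℤ⟦X⟧) : substNegYZHom H = substNegYZ H := rfl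

theorem yz_eq_C_mul_z : (yz : ZY⸨X⸩) = HahnSeries.C (y : ZY) * (z : ZY⸨X⸩) := by
  change HahnSeries.single 1 (y : ZY) = HahnSeries.C (y : ZY) * HahnSeries.single 1 1
  simp

theorem substNegYZHom_X : substNegYZHom PowerSeries.X = -(yz : ZY⸨X⸩) := by
  rw [yz_eq_C_mul_z]
  simp only [substNegYZHom, RingHom.comp_apply, PowerSeries.map_X, PowerSeries.rescale_X, map_mul,
    HahnSeries.ofPowerSeries_X, HahnSeries.ofPowerSeries_C, map_neg, neg_mul]
  rfl

theorem neg_z_zpow_mul_neg_yz_pow (j : ℕ) :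
    (((-z) ^ (-(j : ℤ)) : ZY⸨X⸩ˣ) : ZY⸨X⸩) * (-(yz : ZY⸨X⸩)) ^ j =
      HahnSeries.C ((y ^ (j : ℤ) : ZYˣ) : ZY) := by
  have h : (-(yz : ZY⸨X⸩)) ^ j =
      HahnSeries.C ((y ^ (j : ℤ) : ZYˣ) : ZY) * (((-z) ^ (j : ℤ) : ZY⸨X⸩ˣ) : ZY⸨X⸩) := by
    rw [yz_eq_C_mul_z, ← mul_neg, mul_pow, zpow_natCast, zpow_natCast, Units.val_pow_eq_pow_val,
      Units.val_pow_eq_pow_val, Units.val_neg, map_pow]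
  rw [h, mul_left_comm, zpow_neg, Units.inv_mul, mul_one]

/-- The signs `(-1)^i` of the Euler characteristic cancel against those of `(-yz)^i`; the factor
`y^j` shifts the internal degree to `i + j`. -/
theorem substNegYZ_mk (b : ℕ → ℕ) (j : ℤ) :
    HahnSeries.C ((y ^ j : ZYˣ) : ZY) *
        substNegYZ (PowerSeries.mk fun i => (-1 : ℤ) ^ i * (b i : ℤ)) =
      HahnSeries.ofPowerSeries ℤ ZY
        (PowerSeries.mk fun i : ℕ => (b i : ZY) * ((y ^ ((i : ℤ) + j) : ZYˣ) : ZY)) := by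
  unfold substNegYZ
  rw [← HahnSeries.ofPowerSeries_C, ← map_mul]
  congr 1
  ext i
  rw [PowerSeries.coeff_C_mul, PowerSeries.coeff_rescale, PowerSeries.coeff_map,
    PowerSeries.coeff_mk, PowerSeries.coeff_mk, zpow_add, zpow_natCast, Units.val_mul,
    Units.val_pow_eq_pow_val, neg_pow]
  have h : ((-1 : ZY) ^ i) * (-1) ^ i = 1 := by rw [← mul_pow]; simp
  simp only [map_mul, map_pow, map_neg, map_one, map_natCast]
  linear_combination ((y ^ j : ZYˣ) : ZY) * (y : ZY) ^ i * (b i : ZY) * h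

end Substitution

/-! ### Assembling the Poincaré series from its strands. -/

section Poincare

variable {σ k : Type*} [Field k] [Fintype σ] [LinearOrder σ]
  {I : HomogeneousIdeal (MvPolynomial.homogeneousSubmodule σ k)}

/-- Since `H_{B/J}` and the series of `J` add up to the series of `B`, the difference of quotient
series is the reversed difference of ideal series. The factor `X^j` becomes `(-yz)^j`, and
`(-z)^{-j}` turns it into `y^j`. -/
theorem ofPowerSeries_strand (hI : IsComponentwiseLinear I) (j : ℕ) :
    HahnSeries.ofPowerSeries ℤ ZY (PowerSeries.mk fun i : ℕ =>
        (gradedBetti I i (i + j : ℤ) : ZY) * ((y ^ ((i : ℤ) + j) : ZYˣ) : ZY)) =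
      (1 + (yz : ZY⸨X⸩)) ^ Fintype.card σ *
          ((((-z) ^ (-(j : ℤ)) : ZY⸨X⸩ˣ) : ZY⸨X⸩) *
            (substNegYZ (hilbertSeries (componentIdeal I (j - 1 : ℤ))) -
              substNegYZ (hilbertSeries (componentIdeal I j)))) +
        (1 + (yz : ZY⸨X⸩)) ^ Fintype.card σ *
          ((((-z) ^ (-(j : ℤ)) : ZY⸨X⸩ˣ) : ZY⸨X⸩) * (componentRank I (j - 1 : ℤ) : ZY⸨X⸩) *
            (((-yz) ^ (j - 1 : ℤ) : ZY⸨X⸩ˣ) : ZY⸨X⸩)) := by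
  have h := congrArg substNegYZHom (one_sub_X_pow_mul_eq hI j)
  have hH := congrArg substNegYZHom ((hilbertSeries_add_idealSeries (componentIdeal I j)).trans
    (hilbertSeries_add_idealSeries (componentIdeal I (j - 1 : ℤ))).symm)
  simp only [map_mul, map_add, map_sub, map_pow, map_one, map_natCast, substNegYZHom_X] at h hH
  rw [sub_neg_eq_add] at h
  have hn : (-(yz : ZY⸨X⸩)) ^ (j - 1) * (componentRank I (j - 1 : ℤ) : ZY⸨X⸩) =
      (componentRank I (j - 1 : ℤ) : ZY⸨X⸩) * (((-yz) ^ (j - 1 : ℤ) : ZY⸨X⸩ˣ) : ZY⸨X⸩) := by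
    rcases Nat.eq_zero_or_pos j with rfl | hj
    · rw [componentRank_eq_zero (component_of_neg I (by norm_num))]
      simp
    · have hj' : (j : ℤ) - 1 = ((j - 1 : ℕ) : ℤ) := by omega
      rw [hj', zpow_natCast, Units.val_pow_eq_pow_val, Units.val_neg, mul_comm]
  rw [← substNegYZ_mk, ← neg_z_zpow_mul_neg_yz_pow, mul_assoc, ← substNegYZHom_apply,
    ← substNegYZHom_apply, ← substNegYZHom_apply, ← h]
  linear_combination (1 + (yz : ZY⸨X⸩)) ^ Fintype.card σ *
    (((-z) ^ (-(j : ℤ)) : ZY⸨X⸩ˣ) : ZY⸨X⸩) * (hn + hH)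

theorem poincareCoeff_eq_sum (hI : IsComponentwiseLinear I) (hJ : (generatorDegrees I).Finite)
    (i : ℕ) : poincareCoeff I i =
      ∑ j ∈ hJ.toFinset, (gradedBetti I i (i + j) : ZY) * ((y ^ ((i : ℤ) + j) : ZYˣ) : ZY) := by
  rw [← Finset.sum_image (g := fun j : ℤ => (i : ℤ) + j) (f := fun h : ℤ =>
    (gradedBetti I i h : ZY) * ((y ^ h : ZYˣ) : ZY)) (fun _ _ _ _ h => by simpa using h)]
  refine Finset.sum_subset ?_ ?_
  · intro h hh
    rw [Set.Finite.mem_toFinset, Function.mem_support] at hh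
    refine Finset.mem_image.mpr ⟨h - i, ?_, by ring⟩
    rw [Set.Finite.mem_toFinset]
    by_contra hne
    refine hh ?_
    have h0 := gradedBetti_eq_zero_of_notMem hI hne i
    rwa [add_sub_cancel] at h0
  · intro h _ hh
    rw [Set.Finite.mem_toFinset, Function.mem_support, not_not] at hh
    rw [hh, Nat.cast_zero, zero_mul]

theorem nonneg_of_mem_generatorDegrees {j : ℤ} (hj : j ∈ generatorDegrees I) : 0 ≤ j := by
  by_contra h
  refine hj ?_
  rw [component_of_neg I (by omega), component_of_neg I (by omega), Submodule.mul_bot]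

end Poincare

end GradedPoly

theorem proposition7 {σ k : Type*} [Fintype σ] [Field k]
    (I : HomogeneousIdeal (MvPolynomial.homogeneousSubmodule σ k))
    (hI : GradedPoly.IsComponentwiseLinear I) :
    ∃ hJ : (GradedPoly.generatorDegrees I).Finite,
      HahnSeries.ofPowerSeries ℤ GradedPoly.ZY (GradedPoly.poincareSeries I) =
        (1 + (GradedPoly.yz : GradedPoly.ZY⸨X⸩)) ^ Fintype.card σ *
            ∑ j ∈ hJ.toFinset,
              (((-GradedPoly.z) ^ (-j) : GradedPoly.ZY⸨X⸩ˣ) : GradedPoly.ZY⸨X⸩) *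
                (GradedPoly.substNegYZ
                    (GradedPoly.hilbertSeries (GradedPoly.componentIdeal I (j - 1))) -
                  GradedPoly.substNegYZ
                    (GradedPoly.hilbertSeries (GradedPoly.componentIdeal I j))) +
          (1 + (GradedPoly.yz : GradedPoly.ZY⸨X⸩)) ^ Fintype.card σ *
            ∑ j ∈ hJ.toFinset,
              (((-GradedPoly.z) ^ (-j) : GradedPoly.ZY⸨X⸩ˣ) : GradedPoly.ZY⸨X⸩) *
                (GradedPoly.componentRank I (j - 1) : GradedPoly.ZY⸨X⸩) *
                (((-GradedPoly.yz) ^ (j - 1) : GradedPoly.ZY⸨X⸩ˣ) : GradedPoly.ZY⸨X⸩) := by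

  -- Any order will do: it only fixes the signs in the Koszul complex and does not enter the
  -- statement.
  let : LinearOrder σ := LinearOrder.lift' (Fintype.equivFin σ) (Equiv.injective _)
  have hJ : (GradedPoly.generatorDegrees I).Finite :=
    (GradedPoly.finite_support_gradedBetti I 0).subset (GradedPoly.generatorDegrees_subset I)
  refine ⟨hJ, ?_⟩
  have hsum : GradedPoly.poincareSeries I = ∑ j ∈ hJ.toFinset, PowerSeries.mk fun i : ℕ =>
      (GradedPoly.gradedBetti I i (i + j) : GradedPoly.ZY) *
        ((GradedPoly.y ^ ((i : ℤ) + j) : GradedPoly.ZYˣ) : GradedPoly.ZY) := by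
    ext i
    rw [GradedPoly.poincareSeries, PowerSeries.coeff_mk, GradedPoly.poincareCoeff_eq_sum hI hJ,
      map_sum]
    simp only [PowerSeries.coeff_mk]
  rw [hsum, map_sum, Finset.mul_sum, Finset.mul_sum, ← Finset.sum_add_distrib]
  refine Finset.sum_congr rfl fun j hj => ?_
  obtain ⟨n, rfl⟩ := Int.eq_ofNat_of_zero_le
    (GradedPoly.nonneg_of_mem_generatorDegrees (hJ.mem_toFinset.mp hj))
  exact GradedPoly.ofPowerSeries_strand hI n
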